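/- Let $F$ be a field of characteristic zero, let $n\ge 0$, and let $S=\{(i\ \,i+1) : 1\le i<n\}$ be the set of Coxeter generators of the symmetric group $S_n$. For a subset $\mathcal K\subseteq S_n$ let $V_{\mathcal K}$ be the $F$-vector space with basis $\{C_w : w\in\mathcal K\}$. A pair $(\rho,\mathcal K)$, where $\rho$ is a representation of $S_n$ on $V_{\mathcal K}$, is an abstract Young (AY) pair if for all $s\in S$ and $w\in\mathcal K$ there are scalars $a_s(w),b_s(w)\in F$ with $$\rho_s(C_w)=a_s(w)\,C_w+b_s(w)\,C_{ws},$$ where $b_s(w)=0$ if $ws\notin\mathcal K$. It is minimal if $\mathcal K\neq\emptyset$ and there is no $\emptyset\subsetneq\mathcal K'\subsetneq\mathcal K$ such that $V_{\mathcal K'}=\mathrm{span}\{C_w : w\in\mathcal K'\}$ is $\rho$-invariant; then $\mathcal K$ is called a minimal AY cell and $\rho$ a minimal AY representation. Let $\lambda$ be a partition of $n$ and let $Q$ be a standard Young tableau of shape $\lambda$. For $\pi\in S_n$ let $Q^\pi$ be the tableau obtained from $Q$ by replacing each entry $i$ by $\pi(i)$, and put $$\mathcal K_Q=\{\pi\in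 S_n : Q^{\pi^{-1}}\text{ is standard}\}.$$ Let $S^\lambda$ be the Specht module over $F$, that is, the span of all polytabloids $e_t=\sum_{\pi}\operatorname{sgn}(\pi)\{\pi t\}$ (the sum over the column stabilizer of the tableau $t$ of shape $\lambda$) in the permutation module on the tabloids of shape $\lambda$. Then $\mathcal K_Q$ is a minimal AY cell. Moreover, $S^\lambda$ is irreducible, and there is a minimal AY pair $(\rho,\mathcal K_Q)$ with $\rho$ isomorphic to $S^\lambda$. In particular, every irreducible representation of $S_n$ over $F$ is isomorphic to a minimal AY representation, i.e. to $\rho$ for some minimal AY pair $(\rho,\mathcal K)$ with $\mathcal K\subseteq S_n$. -/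

import Mathlib

/-! ### Abstract Young pairs

Here `W` is a group with a set `S` of generators (in the theorem: the symmetric group with the
adjacent transpositions), `K` is a subset of `W`, and `V_K` is the space `K →₀ F` with basis
`C_w`, `w ∈ K`. -/

section AbstractYoung

variable (F : Type*) [Field F] {W : Type*} [Group W]

open Classical in
/-- The basis vector `C_w` of `V_K = K →₀ F` for `w ∈ K`. For `w ∉ K` it is `0`; such vectors only
occur with a zero coefficient. -/
noncomputable def cellVector (K : Set W) (w : W) : K →₀ F :=
  if h : w ∈ K then Finsupp.single ⟨w, h⟩ 1 else 0

variable {F}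

/-- Axiom (A): `ρ_s C_w = a_s(w) C_w + b_s(w) C_{ws}` for `s ∈ S`, `w ∈ K`, where `b_s(w) = 0`
if `ws ∉ K`. -/
def IsAYPair (S K : Set W) (ρ : Representation F W (K →₀ F)) : Prop :=
  ∀ s ∈ S, ∀ w ∈ K, ∃ a b : F, (w * s ∉ K → b = 0) ∧
    ρ s (cellVector F K w) = a • cellVector F K w + b • cellVector F K (w * s)

/-- The coordinate subspace `V_{K'}` of `V_K`, for `K' ⊆ K`. -/
noncomputable def cellSubspace (F : Type*) [Field F] (K K' : Set W) : Submodule F (K →₀ F) :=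
  Submodule.span F (cellVector F K '' K')

/-- A minimal abstract Young pair: `K` is nonempty, and no proper nonempty subset `K'` of `K` has a
`ρ`-invariant coordinate subspace `V_{K'}`. -/
structure IsMinimalAYPair (S K : Set W) (ρ : Representation F W (K →₀ F)) : Prop where
  isAYPair : IsAYPair S K ρ
  nonempty : K.Nonempty
  minimal : ∀ K' : Set W, K' ⊂ K → K'.Nonempty →
    ¬ ∀ g : W, ∀ v ∈ cellSubspace F K K', ρ g v ∈ cellSubspace F K K'

/-- `K` is a minimal abstract Young cell (over the field `F`). -/
def IsMinimalAYCell (F : Type*) [Field F] (S K : Set W) : Prop :=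
  ∃ ρ : Representation F W (K →₀ F), IsMinimalAYPair S K ρ

end AbstractYoung

/-- The Coxeter generators of the symmetric group: the adjacent transpositions `(i, i + 1)`. -/
def adjacentTranspositions (n : ℕ) : Set (Equiv.Perm (Fin n)) :=
  {s | ∃ i j : Fin n, (i : ℕ) + 1 = j ∧ s = Equiv.swap i j}

/-! ### Young tableaux -/

/-- A tableau of shape `lam`: a bijective filling of the cells of `lam` with the entries `Fin n`
(so that `lam` is a partition of `n`). -/
abbrev Tableau (lam : YoungDiagram) (n : ℕ) : Type :=
  {c : ℕ × ℕ // c ∈ lam} ≃ Fin n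

namespace Tableau

variable {lam : YoungDiagram} {n : ℕ}

/-- The entries increase along every row and down every column. -/
def IsStandard (Q : Tableau lam n) : Prop :=
  (∀ c d : {c : ℕ × ℕ // c ∈ lam}, c.1.1 = d.1.1 → c.1.2 < d.1.2 → Q c < Q d) ∧
  (∀ c d : {c : ℕ × ℕ // c ∈ lam}, c.1.2 = d.1.2 → c.1.1 < d.1.1 → Q c < Q d)

/-- The tableau `Q^π`, obtained from `Q` by replacing each entry `i` by `π i`. -/
def permute (π : Equiv.Perm (Fin n)) (Q : Tableau lam n) : Tableau lam n := Q.trans π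

/-- The row of the entry `i`. -/
def rowOf (Q : Tableau lam n) (i : Fin n) : ℕ := (Q.symm i).1.1

/-- The column of the entry `i`. -/
def colOf (Q : Tableau lam n) (i : Fin n) : ℕ := (Q.symm i).1.2

/-- The set `K_Q` of all permutations `π` such that `Q^(π⁻¹)` is standard. -/
def cell (Q : Tableau lam n) : Set (Equiv.Perm (Fin n)) :=
  {π | (Q.permute π⁻¹).IsStandard}

end Tableau

/-! ### Specht modules -/

/-- Two tableaux are row equivalent if every entry lies in the same row of both. -/
def rowSetoid (lam : YoungDiagram) (n : ℕ) : Setoid (Tableau lam n) where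
  r t u := ∀ i, t.rowOf i = u.rowOf i
  iseqv := ⟨fun _ _ => rfl, fun h i => (h i).symm, fun h k i => (h i).trans (k i)⟩

/-- A tabloid is a row equivalence class of tableaux. -/
def Tabloid (lam : YoungDiagram) (n : ℕ) : Type := Quotient (rowSetoid lam n)

namespace Tabloid

variable {lam : YoungDiagram} {n : ℕ}

/-- The tabloid `{t}` of a tableau `t`. -/
def mk (t : Tableau lam n) : Tabloid lam n := Quotient.mk (rowSetoid lam n) t

/-- The symmetric group acts on tabloids by `π • {t} = {π t}`. -/
instance : MulAction (Equiv.Perm (Fin n)) (Tabloid lam n) where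
  smul π := Quotient.map (Tableau.permute π) (fun _ _ h i => h (π.symm i))
  one_smul x := Quotient.inductionOn x fun _ => rfl
  mul_smul _ _ x := Quotient.inductionOn x fun _ => rfl

theorem smul_mk (π : Equiv.Perm (Fin n)) (t : Tableau lam n) :
    π • mk t = mk (t.permute π) := rfl

end Tabloid

section Specht

variable (F : Type*) [Field F] {lam : YoungDiagram} {n : ℕ}

/-- The column stabilizer of a tableau `t`. -/
def columnStabilizer (t : Tableau lam n) : Finset (Equiv.Perm (Fin n)) :=
  {π | ∀ i, t.colOf (π i) = t.colOf i}

/-- The polytabloid `e_t = ∑ sgn(π) {π t}`, the sum over the column stabilizer of `t`,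
in the permutation module of formal `F`-linear combinations of tabloids (the carrier of Mathlib's
`Representation.ofMulAction`). -/
noncomputable def polytabloid (t : Tableau lam n) : MonoidAlgebra F (Tabloid lam n) :=
  ∑ π ∈ columnStabilizer t,
    MonoidAlgebra.single (Tabloid.mk (t.permute π)) (((Equiv.Perm.sign π : ℤˣ) : ℤ) : F)

theorem ofMulAction_polytabloid (g : Equiv.Perm (Fin n)) (t : Tableau lam n) :
    Representation.ofMulAction F (Equiv.Perm (Fin n)) (Tabloid lam n) g (polytabloid F t) =
      polytabloid F (t.permute g) := by
  unfold polytabloid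
  rw [map_sum]
  refine Finset.sum_bij' (fun π _ => g * π * g⁻¹) (fun π _ => g⁻¹ * π * g) ?_ ?_ ?_ ?_ ?_
  · intro π hπ
    simp only [columnStabilizer, Finset.mem_filter, Finset.mem_univ, true_and] at hπ ⊢
    intro i
    simpa [Tableau.colOf, Tableau.permute] using hπ (g.symm i)
  · intro π hπ
    simp only [columnStabilizer, Finset.mem_filter, Finset.mem_univ, true_and] at hπ ⊢
    intro i
    simpa [Tableau.colOf, Tableau.permute] using hπ (g i)
  · intro π _
    group
  · intro π _
    group
  · intro π _
    rw [Representation.ofMulAction_single, Tabloid.smul_mk]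
    congr 1
    · congr 1
      ext c
      simp [Tableau.permute]
    · have h : Equiv.Perm.sign (g * π * g⁻¹) = Equiv.Perm.sign π := by
        rw [map_mul, map_mul, map_inv, mul_right_comm, mul_inv_cancel, one_mul]
      rw [h]

variable (lam n)

/-- The Specht module `S^lam`: the span of all polytabloids, as a subrepresentation of the
permutation module of the symmetric group on tabloids of shape `lam`. -/
noncomputable def spechtModule : Subrepresentation
    (Representation.ofMulAction F (Equiv.Perm (Fin n)) (Tabloid lam n)) where
  toSubmodule := Submodule.span F (Set.range fun t : Tableau lam n => polytabloid F t)
  apply_mem_toSubmodule g v hv := by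
    induction hv using Submodule.span_induction with
    | mem x hx =>
      obtain ⟨t, rfl⟩ := hx
      rw [ofMulAction_polytabloid]
      exact Submodule.subset_span ⟨_, rfl⟩
    | zero => simp
    | add x y _ _ hx hy => rw [map_add]; exact add_mem hx hy
    | smul c x _ hx => rw [map_smul]; exact Submodule.smul_mem _ c hx

end Specht

/-! The representation is Young's seminormal form. To `w` in the cell of `Q` belongs the standard
tableau `Q^(w⁻¹)`. For `s = (i i+1)` let `d` be the difference of the contents of `i+1` and `i` in
it; `d` is nonzero, and right multiplication by `s` leaves the cell exactly when `d = ±1`. Put `C_w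
↦ d⁻¹ C_w + g(d) C_{ws}` with `g(d) = 1 + d⁻¹`, except `g(±1) = 0`. The Coxeter relations reduce to
`g(d) g(-d) = 1 - d⁻²` and `x⁻¹ y⁻¹ = (x+y)⁻¹ (x⁻¹ + y⁻¹)`, and since these relations present the
symmetric group (`IsCoxeterFamily.exists_monoidHom`), a representation results.

Minimality: `g` is nonzero along every edge `w, ws` inside the cell, and every `w` in the cell is
joined to `1` by removing descents without leaving the cell. So an invariant subspace containing one
`C_w` contains all (`cellVector_mem_iff`).

Isomorphism with the Specht module: the basis vector of the standard tableau filled row by row is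
fixed by its row stabilizer, and that of the tableau filled column by column transforms by the sign
under its column stabilizer. Each generates the representation. The first yields a surjection from
the permutation module on tabloids; the second, moved to the same tableau, shows that the surjection
does not vanish on the polytabloid (`nonempty_equiv_specht`). Irreducibility of the Specht module
follows from Maschke's theorem, because the column antisymmetrizer maps onto a line.

Completeness is a count: Specht modules of distinct shapes are not isomorphic, each conjugacy class
supplies a shape, and characters of non-isomorphic irreducibles are orthogonal with nonzero norm
over any field of characteristic zero. One further irreducible would give more independent class
functions than classes. -/

/-! ### The Coxeter presentation of the symmetric group -/

section Presentation

/-- The Coxeter relations of type `A_{n-1}` for `σ 0, …, σ (n - 2)`. -/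
structure IsCoxeterFamily {M : Type*} [Monoid M] (n : ℕ) (σ : ℕ → M) : Prop where
  sq : ∀ i, i + 1 < n → σ i * σ i = 1
  comm : ∀ i j, i + 1 < j → j + 1 < n → σ i * σ j = σ j * σ i
  braid : ∀ i, i + 2 < n → σ i * σ (i + 1) * σ i = σ (i + 1) * σ i * σ (i + 1)

/-- The product `σ (k - 1) * ⋯ * σ 1 * σ 0`. -/
def descProd {M : Type*} [Monoid M] (σ : ℕ → M) : ℕ → M
  | 0 => 1
  | k + 1 => σ k * descProd σ k

namespace IsCoxeterFamily

variable {M : Type*} [Monoid M] {n : ℕ} {σ : ℕ → M}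

theorem mul_descProd_of_lt (h : IsCoxeterFamily n σ) {i k : ℕ} (hk : k < i) (hi : i + 1 < n) :
    σ i * descProd σ k = descProd σ k * σ i := by
  induction k with
  | zero => simp [descProd]
  | succ k ih =>
    rw [descProd, ← mul_assoc, ← h.comm k i hk hi, mul_assoc, ih (by omega), mul_assoc]

/-- Moving `σ i` past the word raises its index by one: it commutes until it meets `σ (i + 1) * σ
i`, where the braid relation turns it into `σ (i + 1)`, which commutes with the rest. -/
theorem mul_descProd_of_gt (h : IsCoxeterFamily n σ) {i k : ℕ} (hk : i + 1 < k) (hn : k < n) :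
    σ i * descProd σ k = descProd σ k * σ (i + 1) := by
  induction k with
  | zero => omega
  | succ k ih =>
    rcases Nat.lt_succ_iff_lt_or_eq.mp hk with hk' | rfl
    · rw [descProd, ← mul_assoc, h.comm i k hk' (by omega), mul_assoc, ih hk' (by omega), mul_assoc]
    · rw [descProd, descProd, ← mul_assoc, ← mul_assoc, h.braid i (by omega), mul_assoc,
        h.mul_descProd_of_lt (Nat.lt_succ_self i) (by omega)]
      simp only [mul_assoc]

theorem shift (h : IsCoxeterFamily (n + 1) σ) : IsCoxeterFamily n (fun i => σ (i + 1)) where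
  sq i hi := h.sq _ (by omega)
  comm i j hij hj := h.comm _ _ (by omega) (by omega)
  braid i hi := h.braid _ (by omega)

end IsCoxeterFamily

/-- The transposition `(i, i + 1)` of `Fin n`, or `1` if there is none. -/
def adjSwap (n i : ℕ) : Equiv.Perm (Fin n) :=
  if h : i + 1 < n then Equiv.swap ⟨i, by omega⟩ ⟨i + 1, h⟩ else 1

theorem adjSwap_eq {n i : ℕ} (h : i + 1 < n) :
    adjSwap n i = Equiv.swap ⟨i, by omega⟩ ⟨i + 1, h⟩ := dif_pos h

theorem adjSwap_val {n i : ℕ} (h : i + 1 < n) (x : Fin n) :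
    (adjSwap n i x : ℕ) = if (x : ℕ) = i then i + 1 else if (x : ℕ) = i + 1 then i else x := by
  rw [adjSwap_eq h, Equiv.swap_apply_def]
  simp only [Fin.ext_iff]
  split_ifs <;> rfl

theorem isCoxeterFamily_adjSwap (n : ℕ) : IsCoxeterFamily n (adjSwap n) where
  sq i hi := by rw [adjSwap_eq hi, Equiv.swap_mul_self]
  comm i j hij hj := by
    ext x
    simp only [Equiv.Perm.mul_apply, adjSwap_val hj, adjSwap_val (show i + 1 < n by omega)]
    split_ifs <;> omega
  braid i hi := by
    ext x
    simp only [Equiv.Perm.mul_apply, adjSwap_val (show i + 1 + 1 < n by omega),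
      adjSwap_val (show i + 1 < n by omega)]
    split_ifs <;> omega

/-- Generation as a monoid spares the later induction on words a step for inverses. -/
theorem closure_adjSwap (n : ℕ) :
    Submonoid.closure {s | ∃ i, i + 1 < n ∧ s = adjSwap n i} = ⊤ := by
  cases n with
  | zero => exact Subsingleton.elim _ _
  | succ n =>
    rw [← top_le_iff, ← Equiv.Perm.mclosure_swap_castSucc_succ n]
    refine Submonoid.closure_mono ?_
    rintro _ ⟨i, rfl⟩
    exact ⟨i, by omega, by rw [adjSwap_eq (by omega)]; rfl⟩

/-- The embedding of `Perm (Fin n)` into `Perm (Fin (n + 1))` as the stabilizer of `0`. -/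
noncomputable def liftPerm (n : ℕ) : Equiv.Perm (Fin n) →* Equiv.Perm (Fin (n + 1)) :=
  Equiv.Perm.viaEmbeddingHom (Fin.succEmb n)

theorem liftPerm_succ {n : ℕ} (g : Equiv.Perm (Fin n)) (x : Fin n) :
    liftPerm n g x.succ = (g x).succ :=
  Equiv.Perm.viaEmbedding_apply g (Fin.succEmb n) x

theorem liftPerm_zero {n : ℕ} (g : Equiv.Perm (Fin n)) : liftPerm n g 0 = 0 :=
  Equiv.Perm.viaEmbedding_apply_of_notMem g (Fin.succEmb n) 0
    (by rintro ⟨x, hx⟩; exact Fin.succ_ne_zero x hx)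

theorem liftPerm_adjSwap {n i : ℕ} (h : i + 1 < n) :
    liftPerm n (adjSwap n i) = adjSwap (n + 1) (i + 1) := by
  ext x
  rw [adjSwap_val (by omega)]
  refine Fin.cases ?_ (fun y => ?_) x
  · simp [liftPerm_zero]
  · rw [liftPerm_succ, Fin.val_succ, adjSwap_val h, Fin.val_succ]
    split_ifs <;> omega

theorem descProd_adjSwap_zero {n k : ℕ} (hk : k < n + 1) :
    (descProd (adjSwap (n + 1)) k 0 : ℕ) = k := by
  induction k with
  | zero => simp [descProd]
  | succ k ih =>
    rw [descProd, Equiv.Perm.mul_apply, adjSwap_val hk, ih (by omega), if_pos rfl]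

/-- A family satisfying the Coxeter relations extends to a homomorphism on the symmetric group. -/
theorem IsCoxeterFamily.exists_monoidHom {M : Type*} [Monoid M] {n : ℕ} {σ : ℕ → M}
    (h : IsCoxeterFamily n σ) :
    ∃ φ : Equiv.Perm (Fin n) →* M, ∀ i, i + 1 < n → φ (adjSwap n i) = σ i := by
  induction n generalizing σ with
  | zero => exact ⟨1, fun i hi => by omega⟩
  | succ n ih =>
    obtain ⟨ψ, hψ⟩ := ih h.shift
    let s := adjSwap (n + 1)
    have hs : IsCoxeterFamily (n + 1) s := isCoxeterFamily_adjSwap (n + 1)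
    -- Normal form: `g` is uniquely `s (k-1) ⋯ s 0` times a permutation fixing `0`, with `k = g 0`.
    -- The relation `R` is the graph of the map that copies this word into `M`, with `ψ` taking care
    -- of the second factor.
    let R : Equiv.Perm (Fin (n + 1)) → M → Prop := fun g m => ∃ k, k < n + 1 ∧
      ∃ x, g = descProd s k * liftPerm n x ∧ m = descProd σ k * ψ x
    have hfun : ∀ g m m', R g m → R g m' → m = m' := by
      rintro g m m' ⟨k, hk, x, hx, rfl⟩ ⟨k', hk', x', hx', rfl⟩
      have e0 : ∀ k < n + 1, ∀ x, g = descProd s k * liftPerm n x → ((g 0 : Fin _) : ℕ) = k := by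
        rintro k hk x rfl
        rw [Equiv.Perm.mul_apply, liftPerm_zero, descProd_adjSwap_zero hk]
      obtain rfl : k = k' := (e0 k hk x hx).symm.trans (e0 k' hk' x' hx')
      have : x = x' := Equiv.Perm.viaEmbeddingHom_injective (Fin.succEmb n)
        (mul_left_cancel (hx.symm.trans hx'))
      rw [this]
    have hstep : ∀ i, i + 1 < n + 1 → ∀ g m, R g m → R (s i * g) (σ i * m) := by
      rintro i hi g m ⟨k, hk, x, rfl, rfl⟩
      -- A generator lengthens the word (`k = i`), shortens it (`k = i + 1`), or passes through it
      -- and is absorbed by the stabilizer of `0`, with its index kept (`k < i`) or raised (`k > i +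
      -- 1`).
      rcases lt_trichotomy k i with hki | rfl | hki
      · obtain ⟨j, rfl⟩ : ∃ j, i = j + 1 := ⟨i - 1, by omega⟩
        refine ⟨k, hk, adjSwap n j * x, ?_, ?_⟩
        · rw [← mul_assoc, hs.mul_descProd_of_lt hki hi, map_mul, liftPerm_adjSwap (by omega),
            mul_assoc]
        · rw [← mul_assoc, h.mul_descProd_of_lt hki hi, map_mul, hψ j (by omega), mul_assoc]
      · exact ⟨k + 1, hi, x, by rw [descProd, mul_assoc], by rw [descProd, mul_assoc]⟩
      · rcases Nat.lt_or_ge (i + 1) k with hki' | hki'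
        · refine ⟨k, hk, adjSwap n i * x, ?_, ?_⟩
          · rw [← mul_assoc, hs.mul_descProd_of_gt hki' hk, map_mul, liftPerm_adjSwap (by omega),
              mul_assoc]
          · rw [← mul_assoc, h.mul_descProd_of_gt hki' hk, map_mul, hψ i (by omega), mul_assoc]
        · obtain rfl : k = i + 1 := by omega
          refine ⟨i, by omega, x, ?_, ?_⟩
          · rw [descProd, ← mul_assoc, ← mul_assoc, hs.sq i hi, one_mul]
          · rw [descProd, ← mul_assoc, ← mul_assoc, h.sq i hi, one_mul]
    have hone : R 1 1 := ⟨0, by omega, 1, by simp [descProd], by simp [descProd]⟩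
    -- Existence is proved together with stability of `R` under left multiplication by `(g, m)`;
    -- with uniqueness, the second half makes the chosen map multiplicative.
    have hex : ∀ g, ∃ m, R g m ∧ ∀ g' m', R g' m' → R (g * g') (m * m') := by
      intro g
      have hg : g ∈ Submonoid.closure {s | ∃ i, i + 1 < n + 1 ∧ s = adjSwap (n + 1) i} := by
        rw [closure_adjSwap]; trivial
      induction hg using Submonoid.closure_induction with
      | mem x hx =>
        obtain ⟨i, hi, rfl⟩ := hx
        exact ⟨σ i, by simpa using hstep i hi 1 1 hone, hstep i hi⟩
      | one => exact ⟨1, hone, fun g' m' hm => by simpa using hm⟩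
      | mul x y _ _ hx hy =>
        obtain ⟨m, hm, hm'⟩ := hx
        obtain ⟨l, hl, hl'⟩ := hy
        exact ⟨m * l, hm' _ _ hl, fun g' m' h' => by
          rw [mul_assoc, mul_assoc]; exact hm' _ _ (hl' _ _ h')⟩
    choose φ hφ hφ' using hex
    refine ⟨⟨⟨φ, hfun _ _ _ (hφ 1) hone⟩, fun x y =>
      hfun _ _ _ (hφ (x * y)) (hφ' x y _ (hφ y))⟩, fun i hi => ?_⟩
    exact hfun _ _ _ (hφ _) (by simpa using hstep i hi 1 1 hone)

/-- Every permutation is reached from `1` by steps that create a descent. -/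
theorem Equiv.Perm.descent_induction {n : ℕ} {P : Equiv.Perm (Fin n) → Prop} (one : P 1)
    (step : ∀ (π : Equiv.Perm (Fin n)) (i j : Fin n), (i : ℕ) + 1 = j → π j < π i →
      P (π * Equiv.swap i j) → P π) (π : Equiv.Perm (Fin n)) : P π := by
  by_cases hmono : ∀ i j : Fin n, (i : ℕ) + 1 = j → π i < π j
  · suffices π = 1 by rw [this]; exact one
    cases n with
    | zero => exact Subsingleton.elim _ _
    | succ n =>
      have hm : StrictMono π := Fin.strictMono_iff_lt_succ.mpr fun i => hmono _ _ (by simp)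
      exact Equiv.ext fun x => congrFun
        ((StrictMono.range_inj hm strictMono_id).mp (by simp [π.surjective.range_eq])) x
  · push Not at hmono
    obtain ⟨i, j, hij, hle⟩ := hmono
    have hne : i ≠ j := fun e => by subst e; omega
    have hlt : π j < π i := lt_of_le_of_ne hle fun e => hne (π.injective e).symm
    exact step π i j hij hlt (descent_induction one step (π * Equiv.swap i j))
-- By the rearrangement inequality, removing a descent at adjacent positions raises the sum by `π i
-- - π j > 0`; the sum is bounded by `n ^ 3`, so the truncated subtraction does decrease.
termination_by n * (n * n) - ∑ x : Fin n, (x : ℕ) * (π x : ℕ)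
decreasing_by
  have hbound : ∀ π : Equiv.Perm (Fin n), ∑ x : Fin n, (x : ℕ) * (π x : ℕ) ≤ n * (n * n) := by
    intro π
    calc ∑ x : Fin n, (x : ℕ) * (π x : ℕ) ≤ ∑ _x : Fin n, n * n :=
          Finset.sum_le_sum fun x _ => Nat.mul_le_mul x.2.le (π x).2.le
      _ = n * (n * n) := by simp
  have hsum : ∀ f : Fin n → ℕ, ∑ x, f x =
      f i + (f j + ∑ x ∈ (Finset.univ.erase i).erase j, f x) := fun f => by
    rw [Finset.add_sum_erase _ f (Finset.mem_erase.mpr ⟨hne.symm, Finset.mem_univ j⟩),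
      Finset.add_sum_erase _ f (Finset.mem_univ i)]
  have key : ∑ x : Fin n, (x : ℕ) * (π x : ℕ) <
      ∑ x : Fin n, (x : ℕ) * ((π * Equiv.swap i j) x : ℕ) := by
    rw [hsum, hsum (fun x => (x : ℕ) * ((π * Equiv.swap i j) x : ℕ))]
    have hrest : ∑ x ∈ (Finset.univ.erase i).erase j, (x : ℕ) * ((π * Equiv.swap i j) x : ℕ) =
        ∑ x ∈ (Finset.univ.erase i).erase j, (x : ℕ) * (π x : ℕ) := by
      refine Finset.sum_congr rfl fun x hx => ?_
      simp only [Finset.mem_erase] at hx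
      rw [Equiv.Perm.mul_apply, Equiv.swap_apply_of_ne_of_ne hx.2.1 hx.1]
    rw [hrest]
    simp only [Equiv.Perm.mul_apply, Equiv.swap_apply_left, Equiv.swap_apply_right, ← hij]
    have : (π j : ℕ) < π i := hlt
    nlinarith
  have := hbound (π * Equiv.swap i j)
  omega

end Presentation

/-! ### Standard tableaux -/

namespace Tableau

variable {lam : YoungDiagram} {n : ℕ}

/-- The content (column minus row) of the cell of the entry `i`. -/
def content (T : Tableau lam n) (i : Fin n) : ℤ := (T.colOf i : ℤ) - T.rowOf i

theorem eq_of_rowOf_of_colOf (T : Tableau lam n) {i j : Fin n} (hr : T.rowOf i = T.rowOf j)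
    (hc : T.colOf i = T.colOf j) : i = j :=
  T.symm.injective (Subtype.ext (Prod.ext hr hc))

theorem exists_entry (T : Tableau lam n) {a b : ℕ} (h : (a, b) ∈ lam) :
    ∃ i, T.rowOf i = a ∧ T.colOf i = b :=
  ⟨T ⟨(a, b), h⟩, by simp [rowOf], by simp [colOf]⟩

theorem mem_shape (T : Tableau lam n) (i : Fin n) : (T.rowOf i, T.colOf i) ∈ lam :=
  (T.symm i).2

theorem mem_shape_of_le (T : Tableau lam n) {a b : ℕ} (i : Fin n) (ha : a ≤ T.rowOf i)
    (hb : b ≤ T.colOf i) : (a, b) ∈ lam :=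
  lam.up_left_mem ha hb (T.mem_shape i)

theorem isStandard_iff (T : Tableau lam n) : T.IsStandard ↔
    (∀ i j, T.rowOf i = T.rowOf j → T.colOf i < T.colOf j → i < j) ∧
      (∀ i j, T.colOf i = T.colOf j → T.rowOf i < T.rowOf j → i < j) := by
  constructor
  · rintro ⟨h1, h2⟩
    exact ⟨fun i j hr hc => by simpa using h1 (T.symm i) (T.symm j) hr hc,
      fun i j hr hc => by simpa using h2 (T.symm i) (T.symm j) hr hc⟩
  · rintro ⟨h1, h2⟩
    exact ⟨fun c d hr hc => h1 (T c) (T d) (by simpa [rowOf] using hr) (by simpa [colOf] using hc),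
      fun c d hr hc => h2 (T c) (T d) (by simpa [colOf] using hr) (by simpa [rowOf] using hc)⟩

theorem IsStandard.lt {T : Tableau lam n} (h : T.IsStandard) {i j : Fin n}
    (hr : T.rowOf i ≤ T.rowOf j) (hc : T.colOf i ≤ T.colOf j) (hne : i ≠ j) : i < j := by
  obtain ⟨h1, h2⟩ := T.isStandard_iff.mp h
  rcases hr.eq_or_lt with hr | hr
  · exact h1 i j hr (lt_of_le_of_ne hc fun e => hne (T.eq_of_rowOf_of_colOf hr e))
  rcases hc.eq_or_lt with hc | hc
  · exact h2 i j hc hr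
  obtain ⟨k, hk, hk'⟩ := T.exists_entry (T.mem_shape_of_le j hr.le (le_refl _))
  obtain ⟨l, hl, hl'⟩ := T.exists_entry (T.mem_shape_of_le j hr.le hc.le)
  exact (h1 i k hk.symm (by omega)).trans (h2 k j hk' (by omega))

/-- A cell strictly above and strictly to the right of another exceeds it in content by at least
`2`. -/
theorem comparable_of_content (T : Tableau lam n) {i j : Fin n}
    (h1 : T.content j - T.content i ≤ 1) (h2 : -1 ≤ T.content j - T.content i) :
    (T.rowOf i ≤ T.rowOf j ∧ T.colOf i ≤ T.colOf j) ∨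
      (T.rowOf j ≤ T.rowOf i ∧ T.colOf j ≤ T.colOf i) := by
  unfold content at h1 h2
  omega

/-- Of two cells on one diagonal, the cell to the right of the upper one has an entry strictly
between theirs, which consecutive entries do not allow. -/
theorem IsStandard.content_ne_succ {T : Tableau lam n} (h : T.IsStandard) {i j : Fin n}
    (hij : (i : ℕ) + 1 = j) : T.content j ≠ T.content i := by
  intro e
  have hne : i ≠ j := fun e => by subst e; omega
  have hlt : i < j := Fin.lt_def.mpr (by omega)
  rcases T.comparable_of_content (i := i) (j := j) (by omega) (by omega) with ⟨hr, hc⟩ | ⟨hr, hc⟩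
  · have hr' : T.rowOf i ≠ T.rowOf j := fun hr' => hne (T.eq_of_rowOf_of_colOf hr' (by
      unfold content at e; omega))
    have hc' : T.colOf i < T.colOf j := by unfold content at e; omega
    obtain ⟨k, hk, hk'⟩ := T.exists_entry
      (T.mem_shape_of_le (a := T.rowOf i) (b := T.colOf i + 1) j hr (by omega))
    have h1 : i < k := h.lt (by omega) (by omega) (fun e => by subst e; omega)
    have h2 : k < j := h.lt (by omega) (by omega) (fun e => by subst e; omega)
    rw [Fin.lt_def] at h1 h2
    omega
  · exact absurd (h.lt hr hc hne.symm) hlt.asymm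

/-- Here the cells to the right of and below the upper cell both carry entries strictly between, and
only one value is available. The braid relation needs this so as to invert `x + y`. -/
theorem IsStandard.content_ne_succ_succ {T : Tableau lam n} (h : T.IsStandard) {i j : Fin n}
    (hij : (i : ℕ) + 2 = j) : T.content j ≠ T.content i := by
  intro e
  have hne : i ≠ j := fun e => by subst e; omega
  have hlt : i < j := Fin.lt_def.mpr (by omega)
  rcases T.comparable_of_content (i := i) (j := j) (by omega) (by omega) with ⟨hr, hc⟩ | ⟨hr, hc⟩
  · have hr' : T.rowOf i ≠ T.rowOf j := fun hr' => hne (T.eq_of_rowOf_of_colOf hr' (by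
      unfold content at e; omega))
    have hc' : T.colOf i < T.colOf j := by unfold content at e; omega
    obtain ⟨k, hk, hk'⟩ := T.exists_entry
      (T.mem_shape_of_le (a := T.rowOf i) (b := T.colOf i + 1) j hr (by omega))
    obtain ⟨l, hl, hl'⟩ := T.exists_entry
      (T.mem_shape_of_le (a := T.rowOf i + 1) (b := T.colOf i) j (by omega) hc)
    have h1 : i < k := h.lt (by omega) (by omega) (fun e => by subst e; omega)
    have h2 : k < j := h.lt (by omega) (by omega) (fun e => by subst e; omega)
    have h3 : i < l := h.lt (by omega) (by omega) (fun e => by subst e; omega)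
    have h4 : l < j := h.lt (by omega) (by omega) (fun e => by subst e; omega)
    rw [Fin.lt_def] at h1 h2 h3 h4
    have : k = l := Fin.ext (by omega)
    subst this
    omega
  · exact absurd (h.lt hr hc hne.symm) hlt.asymm

/-! ### Relabelling and exchange of consecutive entries -/

theorem rowOf_permute (T : Tableau lam n) (π : Equiv.Perm (Fin n)) (i : Fin n) :
    (T.permute π).rowOf i = T.rowOf (π⁻¹ i) := rfl

theorem colOf_permute (T : Tableau lam n) (π : Equiv.Perm (Fin n)) (i : Fin n) :
    (T.permute π).colOf i = T.colOf (π⁻¹ i) := rfl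

theorem permute_mul (T : Tableau lam n) (π τ : Equiv.Perm (Fin n)) :
    T.permute (π * τ) = (T.permute τ).permute π := rfl

theorem swap_lt_swap {i j a b : Fin n} (hij : (i : ℕ) + 1 = j) (hab : a < b)
    (h : ¬ (a = i ∧ b = j)) : Equiv.swap i j a < Equiv.swap i j b := by
  rw [Equiv.swap_apply_def, Equiv.swap_apply_def]
  simp only [Fin.ext_iff, Fin.lt_def] at *
  split_ifs <;> omega

/-- Exchanging two consecutive entries of a standard tableau gives a standard tableau if and only
if the contents of their cells do not differ by `1`. -/
theorem IsStandard.permute_swap_iff {T : Tableau lam n} (h : T.IsStandard) {i j : Fin n}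
    (hij : (i : ℕ) + 1 = j) : (T.permute (Equiv.swap i j)).IsStandard ↔
      ¬ (T.content j - T.content i = 1 ∨ T.content j - T.content i = -1) := by
  have hne : i ≠ j := fun e => by subst e; omega
  have hlt : i < j := Fin.lt_def.mpr (by omega)
  constructor
  · intro hs hd
    rcases T.comparable_of_content (i := i) (j := j) (by omega) (by omega) with ⟨hr, hc⟩ | ⟨hr, hc⟩
    · refine hlt.asymm (hs.lt (i := j) (j := i) ?_ ?_ hne.symm)
      · simpa [rowOf_permute] using hr
      · simpa [colOf_permute] using hc
    · exact absurd (h.lt hr hc hne.symm) hlt.asymm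
  · intro hd
    have hrow : T.rowOf i ≠ T.rowOf j := by
      intro e
      have hc : T.colOf i < T.colOf j := by
        by_contra hc
        exact hlt.asymm (h.lt e.ge (by omega) hne.symm)
      obtain ⟨k, hk, hk'⟩ := T.exists_entry
        (T.mem_shape_of_le (a := T.rowOf i) (b := T.colOf i + 1) j e.le (by omega))
      have h1 : i < k := h.lt (by omega) (by omega) (fun e => by subst e; omega)
      have h2 : k < j := h.lt (by omega) (by omega)
        (fun e' => by subst e'; unfold content at hd; omega)
      rw [Fin.lt_def] at h1 h2
      omega
    have hcol : T.colOf i ≠ T.colOf j := by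
      intro e
      have hc : T.rowOf i < T.rowOf j := by
        by_contra hc
        exact hlt.asymm (h.lt (by omega) e.ge hne.symm)
      obtain ⟨k, hk, hk'⟩ := T.exists_entry
        (T.mem_shape_of_le (a := T.rowOf i + 1) (b := T.colOf i) j (by omega) e.le)
      have h1 : i < k := h.lt (by omega) (by omega) (fun e => by subst e; omega)
      have h2 : k < j := h.lt (by omega) (by omega)
        (fun e' => by subst e'; unfold content at hd; omega)
      rw [Fin.lt_def] at h1 h2
      omega
    constructor
    · intro c d hr hc
      refine swap_lt_swap hij (h.1 c d hr hc) ?_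
      rintro ⟨rfl, rfl⟩
      exact hrow (by simpa [rowOf] using hr)
    · intro c d hr hc
      refine swap_lt_swap hij (h.2 c d hr hc) ?_
      rintro ⟨rfl, rfl⟩
      exact hcol (by simpa [colOf] using hr)

/-- Number the cells in the linear order pulled back along `e`. The role of `Q` is to say that the
shape has `n` cells. -/
theorem exists_lt_iff (Q : Tableau lam n) {α : Type*} [LinearOrder α] (e : ℕ × ℕ → α)
    (he : Function.Injective e) : ∃ T : Tableau lam n, ∀ i j, i < j ↔
      e (T.rowOf i, T.colOf i) < e (T.rowOf j, T.colOf j) := by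
  classical
  let s : Finset α := lam.cells.image e
  have hc : s.card = n := by
    rw [Finset.card_image_of_injective _ he]
    simpa using Fintype.card_congr (α := lam.cells) Q
  let f := s.orderIsoOfFin hc
  let g : {c : ℕ × ℕ // c ∈ lam} ≃ s := Equiv.ofBijective
    (fun c => ⟨e c.1, Finset.mem_image_of_mem e c.2⟩)
    ⟨fun c d h => Subtype.ext (he (congrArg Subtype.val h)), fun ⟨x, hx⟩ => by
      obtain ⟨c, hc, rfl⟩ := Finset.mem_image.mp hx
      exact ⟨⟨c, hc⟩, rfl⟩⟩
  have hg : ∀ i, e ((g.trans f.symm.toEquiv).symm i).1 = f i := fun i =>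
    congrArg Subtype.val (g.apply_symm_apply (f i))
  refine ⟨g.trans f.symm.toEquiv, fun i j => ?_⟩
  change i < j ↔ e ((g.trans f.symm.toEquiv).symm i).1 < e ((g.trans f.symm.toEquiv).symm j).1
  rw [hg, hg]
  exact (f.lt_iff_lt (x := i) (y := j)).symm

theorem exists_standard_monotone_rowOf (Q : Tableau lam n) :
    ∃ T : Tableau lam n, T.IsStandard ∧ Monotone T.rowOf := by
  obtain ⟨T, hT⟩ := Q.exists_lt_iff (fun c => toLex c) toLex.injective
  simp only [Prod.Lex.toLex_lt_toLex] at hT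
  refine ⟨T, T.isStandard_iff.mpr ⟨fun i j hr hc => (hT i j).mpr (Or.inr ⟨hr, hc⟩),
    fun i j _ hr => (hT i j).mpr (Or.inl hr)⟩, fun i j hij => ?_⟩
  rcases hij.eq_or_lt with rfl | hij
  · exact le_rfl
  · rcases (hT i j).mp hij with h | h
    · exact h.le
    · exact h.1.le

theorem exists_standard_monotone_colOf (Q : Tableau lam n) :
    ∃ T : Tableau lam n, T.IsStandard ∧ Monotone T.colOf := by
  obtain ⟨T, hT⟩ := Q.exists_lt_iff (fun c => toLex c.swap)
    (toLex.injective.comp Prod.swap_injective)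
  simp only [Prod.swap, Prod.Lex.toLex_lt_toLex] at hT
  refine ⟨T, T.isStandard_iff.mpr ⟨fun i j _ hc => (hT i j).mpr (Or.inl hc),
    fun i j hr hc => (hT i j).mpr (Or.inr ⟨hr, hc⟩)⟩, fun i j hij => ?_⟩
  rcases hij.eq_or_lt with rfl | hij
  · exact le_rfl
  · rcases (hT i j).mp hij with h | h
    · exact h.le
    · exact h.1.le

/-! ### The cell of a tableau -/

theorem mem_cell_iff (Q : Tableau lam n) (w : Equiv.Perm (Fin n)) :
    w ∈ Q.cell ↔ (Q.permute w⁻¹).IsStandard := Iff.rfl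

theorem content_permute_inv (Q : Tableau lam n) (w : Equiv.Perm (Fin n)) (i : Fin n) :
    (Q.permute w⁻¹).content i = Q.content (w i) := rfl

theorem mul_swap_mem_cell_iff {Q : Tableau lam n} {w : Equiv.Perm (Fin n)} (hw : w ∈ Q.cell)
    {i j : Fin n} (hij : (i : ℕ) + 1 = j) : w * Equiv.swap i j ∈ Q.cell ↔
      ¬ (Q.content (w j) - Q.content (w i) = 1 ∨ Q.content (w j) - Q.content (w i) = -1) := by
  rw [mem_cell_iff, mul_inv_rev, Equiv.swap_inv, permute_mul]
  exact IsStandard.permute_swap_iff hw hij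

/-- A descent of `w` can be removed inside the cell of a standard tableau. -/
theorem mul_swap_mem_cell {Q : Tableau lam n} (hQ : Q.IsStandard) {w : Equiv.Perm (Fin n)}
    (hw : w ∈ Q.cell) {i j : Fin n} (hij : (i : ℕ) + 1 = j) (hlt : w j < w i) :
    w * Equiv.swap i j ∈ Q.cell := by
  rw [mul_swap_mem_cell_iff hw hij, ← content_permute_inv, ← content_permute_inv]
  have hne : i ≠ j := fun e => by subst e; omega
  have hlt' : i < j := Fin.lt_def.mpr (by omega)
  intro hd
  -- If the contents differed by `1`, the cells would be comparable: one order contradicts the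
  -- descent because `Q` is standard, the other contradicts `i < j` because the tableau of `w` is.
  rcases (Q.permute w⁻¹).comparable_of_content (i := i) (j := j) (by omega) (by omega) with
    ⟨hr, hc⟩ | ⟨hr, hc⟩
  · exact hlt.asymm (hQ.lt hr hc (fun e => hne (w.injective e)))
  · exact absurd (IsStandard.lt hw hr hc hne.symm) hlt'.asymm

theorem one_mem_cell {Q : Tableau lam n} (hQ : Q.IsStandard) :
    (1 : Equiv.Perm (Fin n)) ∈ Q.cell := by
  rw [mem_cell_iff, inv_one]; exact hQ

end Tableau

/-! ### The seminormal representation on the cell of a standard tableau -/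

section Seminormal

open Tableau

variable (F : Type*) [Field F] {lam : YoungDiagram} {n : ℕ}

theorem cellVector_of_mem {W : Type*} {K : Set W} {w : W} (h : w ∈ K) [Group W] :
    cellVector F K w = Finsupp.single ⟨w, h⟩ 1 := dif_pos h

theorem cellVector_of_notMem {W : Type*} {K : Set W} {w : W} (h : w ∉ K) [Group W] :
    cellVector F K w = 0 := dif_neg h

variable {F} in
theorem cellSpace_hom_ext {W M : Type*} [Group W] [AddCommMonoid M] [Module F M] {K : Set W}
    {f g : (K →₀ F) →ₗ[F] M}
    (h : ∀ w ∈ K, f (cellVector F K w) = g (cellVector F K w)) : f = g := by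
  refine Finsupp.lhom_ext' fun w => LinearMap.ext_ring ?_
  simpa [cellVector_of_mem F w.2] using h w w.2

/-- The off-diagonal coefficient of the seminormal form for two cells with content difference
`d`. -/
noncomputable def seminormalCoeff (d : ℤ) : F :=
  if d = 1 ∨ d = -1 then 0 else 1 + (d : F)⁻¹

-- For `d = 1` the generic formula would give `2`, so the zero is imposed. Otherwise `1 + d⁻¹`
-- vanishes only at `-1`; at `d = 0` it is `1`, by the convention `0⁻¹ = 0`.
variable {F} in
theorem seminormalCoeff_eq_zero [CharZero F] {d : ℤ} :
    seminormalCoeff F d = 0 ↔ d = 1 ∨ d = -1 := by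
  unfold seminormalCoeff
  split_ifs with h
  · simp [h]
  · simp only [h, iff_false]
    intro h0
    have h1 : (d : F)⁻¹ = -1 := by linear_combination h0
    have h2 : (d : F) = ((-1 : ℤ) : F) := by rw [← inv_inv (d : F), h1]; norm_num
    exact h (Or.inr (Int.cast_injective h2))

theorem seminormalCoeff_mul_neg [CharZero F] {d : ℤ} (hd : d ≠ 0) :
    seminormalCoeff F d * seminormalCoeff F (-d) = 1 - (d : F)⁻¹ * (d : F)⁻¹ := by
  have hd' : (d : F) ≠ 0 := Int.cast_ne_zero.mpr hd
  by_cases h : d = 1 ∨ d = -1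
  · rw [seminormalCoeff_eq_zero.mpr h, zero_mul]
    rcases h with rfl | rfl <;> norm_num
  · have h' : ¬ (-d = 1 ∨ -d = -1) := by omega
    rw [seminormalCoeff, seminormalCoeff, if_neg h, if_neg h']
    push_cast
    rw [inv_neg]
    ring

/-- The operator `C_w ↦ d⁻¹ C_w + g(d) C_{ws}` for `s = (i j)`, where `d` is the difference of
the contents of the cells of `j` and `i` in the tableau of `w`. -/
noncomputable def seminormalOp (Q : Tableau lam n) (i j : Fin n) :
    (Q.cell →₀ F) →ₗ[F] (Q.cell →₀ F) :=
  Finsupp.linearCombination F fun w : Q.cell =>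
    ((Q.content (w.1 j) - Q.content (w.1 i) : ℤ) : F)⁻¹ • cellVector F Q.cell w.1 +
      seminormalCoeff F (Q.content (w.1 j) - Q.content (w.1 i)) •
        cellVector F Q.cell (w.1 * Equiv.swap i j)

variable {F} [CharZero F] {Q : Tableau lam n}

/-- The formula persists outside the cell: if only `ws` lies in it, the contents differ by `±1` and
the coefficient vanishes. Products of operators can thus be expanded without checking membership. -/
theorem seminormalOp_cellVector {i j : Fin n} (hij : (i : ℕ) + 1 = j) (w : Equiv.Perm (Fin n)) :
    seminormalOp F Q i j (cellVector F Q.cell w) =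
      ((Q.content (w j) - Q.content (w i) : ℤ) : F)⁻¹ • cellVector F Q.cell w +
        seminormalCoeff F (Q.content (w j) - Q.content (w i)) •
          cellVector F Q.cell (w * Equiv.swap i j) := by
  by_cases hw : w ∈ Q.cell
  · conv_lhs => rw [cellVector_of_mem F hw]
    rw [seminormalOp, Finsupp.linearCombination_single, one_smul]
  · rw [cellVector_of_notMem F hw, map_zero, smul_zero, zero_add]
    by_cases hws : w * Equiv.swap i j ∈ Q.cell
    · have h := (mul_swap_mem_cell_iff hws hij).not
      rw [mul_assoc, Equiv.swap_mul_self, mul_one, not_not] at h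
      have h' := h.mp hw
      simp only [Equiv.Perm.mul_apply, Equiv.swap_apply_left, Equiv.swap_apply_right] at h'
      rw [seminormalCoeff_eq_zero.mpr (by omega), zero_smul]
    · rw [cellVector_of_notMem F hws, smul_zero]

theorem seminormalOp_sq {i j : Fin n} (hij : (i : ℕ) + 1 = j) :
    seminormalOp F Q i j * seminormalOp F Q i j = 1 := by
  refine cellSpace_hom_ext fun w hw => ?_
  have hd : Q.content (w j) - Q.content (w i) ≠ 0 := sub_ne_zero.mpr
    (IsStandard.content_ne_succ hw hij)
  have hg := seminormalCoeff_mul_neg F hd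
  simp only [Module.End.mul_apply, Module.End.one_apply, seminormalOp_cellVector hij, map_add,
    map_smul, Equiv.Perm.mul_apply, Equiv.swap_apply_left, Equiv.swap_apply_right, mul_assoc,
    Equiv.swap_mul_self, mul_one]
  rw [← neg_sub (Q.content (w j)) (Q.content (w i))]
  generalize Q.content (w j) - Q.content (w i) = d at hg ⊢
  push_cast
  rw [inv_neg]
  linear_combination (norm := module) hg • cellVector F Q.cell w

theorem seminormalOp_comm {i j k l : Fin n} (hij : (i : ℕ) + 1 = j) (hkl : (k : ℕ) + 1 = l)
    (h : j < k) :
    seminormalOp F Q i j * seminormalOp F Q k l = seminormalOp F Q k l * seminormalOp F Q i j := by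
  rw [Fin.lt_def] at h
  have hik : i ≠ k := fun e => by subst e; omega
  have hil : i ≠ l := fun e => by subst e; omega
  have hjk : j ≠ k := fun e => by subst e; omega
  have hjl : j ≠ l := fun e => by subst e; omega
  refine cellSpace_hom_ext fun w _ => ?_
  have hcomm : Equiv.swap i j * Equiv.swap k l = Equiv.swap k l * Equiv.swap i j :=
    (Equiv.Perm.disjoint_swap_swap (by simp [*]; omega)).commute.eq
  simp only [Module.End.mul_apply, seminormalOp_cellVector hij, seminormalOp_cellVector hkl,
    map_add, map_smul, Equiv.Perm.mul_apply, Equiv.swap_apply_of_ne_of_ne hik hil,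
    Equiv.swap_apply_of_ne_of_ne hjk hjl, Equiv.swap_apply_of_ne_of_ne hik.symm hjk.symm,
    Equiv.swap_apply_of_ne_of_ne hil.symm hjl.symm, mul_assoc, hcomm]
  module

theorem seminormalOp_braid {i j k : Fin n} (hij : (i : ℕ) + 1 = j) (hjk : (j : ℕ) + 1 = k) :
    seminormalOp F Q i j * seminormalOp F Q j k * seminormalOp F Q i j =
      seminormalOp F Q j k * seminormalOp F Q i j * seminormalOp F Q j k := by
  have nij : i ≠ j := fun e => by subst e; omega
  have nik : i ≠ k := fun e => by subst e; omega
  have njk : j ≠ k := fun e => by subst e; omega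
  refine cellSpace_hom_ext fun w hw => ?_
  have hx : Q.content (w j) - Q.content (w i) ≠ 0 := sub_ne_zero.mpr
    (IsStandard.content_ne_succ hw hij)
  have hy : Q.content (w k) - Q.content (w j) ≠ 0 := sub_ne_zero.mpr
    (IsStandard.content_ne_succ hw hjk)
  have hz : Q.content (w k) - Q.content (w i) ≠ 0 := sub_ne_zero.mpr
    (IsStandard.content_ne_succ_succ hw (by omega))
  have gx := seminormalCoeff_mul_neg F hx
  have gy := seminormalCoeff_mul_neg F hy
  have gz := seminormalCoeff_mul_neg F hz
  have hbr : Equiv.swap j k * (Equiv.swap i j * Equiv.swap j k) =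
      Equiv.swap i j * (Equiv.swap j k * Equiv.swap i j) := by
    have h := (isCoxeterFamily_adjSwap n).braid i (by omega)
    rw [adjSwap_eq (by omega), adjSwap_eq (by omega)] at h
    have ej : (⟨(i : ℕ) + 1, by omega⟩ : Fin n) = j := Fin.ext hij
    have ek : (⟨(i : ℕ) + 1 + 1, by omega⟩ : Fin n) = k := Fin.ext (by simp [hij, hjk])
    simp only [Fin.eta, ej, ek, mul_assoc] at h
    exact h.symm
  simp only [Module.End.mul_apply, seminormalOp_cellVector hij, seminormalOp_cellVector hjk,
    map_add, map_smul, Equiv.Perm.mul_apply, Equiv.swap_apply_left, Equiv.swap_apply_right,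
    Equiv.swap_apply_of_ne_of_ne nik.symm njk.symm,
    Equiv.swap_apply_of_ne_of_ne nij nik,
    mul_assoc, Equiv.swap_mul_self, mul_one, hbr]
  rw [← neg_sub (Q.content (w j)) (Q.content (w i)), ← neg_sub (Q.content (w k)) (Q.content (w j))]
  have hzz : Q.content (w k) - Q.content (w i) =
    (Q.content (w j) - Q.content (w i)) + (Q.content (w k) - Q.content (w j)) := by ring
  rw [hzz] at hz gz ⊢
  generalize Q.content (w j) - Q.content (w i) = x at *
  generalize Q.content (w k) - Q.content (w j) = y at *
  -- The identity behind the braid relation; the outer contents differ by `x + y`.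
  have hA : (x : F)⁻¹ * (y : F)⁻¹ = ((x + y : ℤ) : F)⁻¹ * ((x : F)⁻¹ + (y : F)⁻¹) := by
    have hx' : (x : F) ≠ 0 := Int.cast_ne_zero.mpr hx
    have hy' : (y : F) ≠ 0 := Int.cast_ne_zero.mpr hy
    have hz' : (x : F) + y ≠ 0 := by exact_mod_cast hz
    push_cast
    field_simp
    ring
  rw [Int.cast_neg x, Int.cast_neg y, inv_neg, inv_neg]
  generalize (x : F)⁻¹ = a at *
  generalize (y : F)⁻¹ = b at *
  generalize ((x + y : ℤ) : F)⁻¹ = c at *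
  generalize seminormalCoeff F x = g1 at *
  generalize seminormalCoeff F y = g2 at *
  generalize seminormalCoeff F (-x) = g3 at *
  generalize seminormalCoeff F (-y) = g4 at *
  generalize seminormalCoeff F (x + y) = g5 at *
  generalize seminormalCoeff F (-(x + y)) = g6 at *
  -- The diagonal coefficients. With `g1 * g3 = 1 - a²` and `g2 * g4 = 1 - b²` the difference
  -- factors as `(a - b) (a b - c (a + b))`.
  have h0 : a * b * a + g1 * c * g3 = b * a * b + g2 * c * g4 := by
    linear_combination c * gx - c * gy + (a - b) * hA
  linear_combination (norm := module) h0 • cellVector F Q.cell w +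
    (g1 * hA) • cellVector F Q.cell (w * Equiv.swap i j) -
    (g2 * hA) • cellVector F Q.cell (w * Equiv.swap j k)

variable (F Q) in
/-- The seminormal operators of the adjacent transpositions, indexed by `ℕ`. -/
noncomputable def seminormalFamily (i : ℕ) : Module.End F (Q.cell →₀ F) :=
  if h : i + 1 < n then seminormalOp F Q ⟨i, by omega⟩ ⟨i + 1, h⟩ else 1

theorem isCoxeterFamily_seminormal : IsCoxeterFamily n (seminormalFamily F Q) where
  sq i hi := by
    rw [seminormalFamily, dif_pos hi]
    exact seminormalOp_sq rfl
  comm i j hij hj := by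
    rw [seminormalFamily, dif_pos (by omega), seminormalFamily, dif_pos hj]
    exact seminormalOp_comm rfl rfl (Fin.lt_def.mpr hij)
  braid i hi := by
    rw [seminormalFamily, dif_pos (by omega), seminormalFamily, dif_pos (by omega)]
    exact seminormalOp_braid rfl rfl

variable (F Q) in
/-- The seminormal representation on the cell of `Q`. -/
noncomputable def seminormalRep : Representation F (Equiv.Perm (Fin n)) (Q.cell →₀ F) :=
  (isCoxeterFamily_seminormal (F := F) (Q := Q)).exists_monoidHom.choose

theorem seminormalRep_swap {i j : Fin n} (hij : (i : ℕ) + 1 = j) (w : Equiv.Perm (Fin n)) :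
    seminormalRep F Q (Equiv.swap i j) (cellVector F Q.cell w) =
      ((Q.content (w j) - Q.content (w i) : ℤ) : F)⁻¹ • cellVector F Q.cell w +
        seminormalCoeff F (Q.content (w j) - Q.content (w i)) •
          cellVector F Q.cell (w * Equiv.swap i j) := by
  have hi : (i : ℕ) + 1 < n := by omega
  have h := (isCoxeterFamily_seminormal (F := F) (Q := Q)).exists_monoidHom.choose_spec i hi
  have ej : (⟨(i : ℕ) + 1, by omega⟩ : Fin n) = j := Fin.ext hij
  rw [adjSwap_eq hi, seminormalFamily, dif_pos hi, ej] at h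
  rw [← seminormalOp_cellVector hij]
  exact LinearMap.congr_fun h _

theorem isAYPair_seminormalRep :
    IsAYPair (adjacentTranspositions n) Q.cell (seminormalRep F Q) := by
  rintro s ⟨i, j, hij, rfl⟩ w hw
  refine ⟨_, _, fun h => ?_, seminormalRep_swap hij w⟩
  rw [mul_swap_mem_cell_iff hw hij, not_not] at h
  exact seminormalCoeff_eq_zero.mpr h

/-- Within the cell of a standard tableau, an invariant subspace contains either all basis vectors
or none. -/
theorem cellVector_mem_iff (hQ : Q.IsStandard) (U : Submodule F (Q.cell →₀ F))
    (hU : ∀ g, ∀ v ∈ U, seminormalRep F Q g v ∈ U) (w : Equiv.Perm (Fin n)) :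
    w ∈ Q.cell → (cellVector F Q.cell w ∈ U ↔ cellVector F Q.cell 1 ∈ U) := by
  have key : ∀ (w : Equiv.Perm (Fin n)) (i j : Fin n), (i : ℕ) + 1 = j → w ∈ Q.cell →
      w * Equiv.swap i j ∈ Q.cell → cellVector F Q.cell w ∈ U →
      cellVector F Q.cell (w * Equiv.swap i j) ∈ U := by
    intro w i j hij hw hws hv
    have h := hU (Equiv.swap i j) _ hv
    rw [seminormalRep_swap hij] at h
    -- Both `w` and `ws` lie in the cell, so the coefficient of `C_{ws}` is nonzero and `C_{ws}` can
    -- be solved for.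
    have hc := seminormalCoeff_eq_zero (F := F).not.mpr ((mul_swap_mem_cell_iff hw hij).mp hws)
    exact (U.smul_mem_iff hc).mp ((U.add_mem_iff_right (U.smul_mem _ hv)).mp h)
  induction w using Equiv.Perm.descent_induction with
  | one => exact fun _ => Iff.rfl
  | step π i j hij hlt ih =>
    intro hπ
    have hs := mul_swap_mem_cell hQ hπ hij hlt
    rw [← ih hs]
    refine ⟨key π i j hij hπ hs, fun h => ?_⟩
    have := key _ i j hij hs (by rwa [mul_assoc, Equiv.swap_mul_self, mul_one]) h
    rwa [mul_assoc, Equiv.swap_mul_self, mul_one] at this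

theorem eq_top_of_cellVector_mem (hQ : Q.IsStandard) (U : Submodule F (Q.cell →₀ F))
    (hU : ∀ g, ∀ v ∈ U, seminormalRep F Q g v ∈ U) {w : Equiv.Perm (Fin n)} (hw : w ∈ Q.cell)
    (hv : cellVector F Q.cell w ∈ U) : U = ⊤ := by
  rw [cellVector_mem_iff hQ U hU w hw] at hv
  have h : U.mkQ = 0 := cellSpace_hom_ext fun x hx => by
    simpa using (cellVector_mem_iff hQ U hU x hx).mpr hv
  rw [← U.ker_mkQ, h, LinearMap.ker_zero]

theorem cellVector_mem_cellSubspace_iff {W : Type*} [Group W] {K K' : Set W} {w : W} (hw : w ∈ K)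
    (hK : K' ⊆ K) : cellVector F K w ∈ cellSubspace F K K' ↔ w ∈ K' := by
  refine ⟨fun h => ?_, fun h => Submodule.subset_span ⟨w, h, rfl⟩⟩
  by_contra hw'
  have hle : cellSubspace F K K' ≤ LinearMap.ker (Finsupp.lapply (⟨w, hw⟩ : K)) := by
    refine Submodule.span_le.mpr ?_
    rintro _ ⟨x, hx, rfl⟩
    rw [cellVector_of_mem F (hK hx)]
    have : (⟨x, hK hx⟩ : K) ≠ ⟨w, hw⟩ := fun e => hw' (Subtype.mk.inj e ▸ hx)
    simp [this]
  have := hle h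
  rw [cellVector_of_mem F hw] at this
  simp at this

theorem isMinimalAYPair_seminormalRep (hQ : Q.IsStandard) :
    IsMinimalAYPair (adjacentTranspositions n) Q.cell (seminormalRep F Q) where
  isAYPair := isAYPair_seminormalRep
  nonempty := ⟨1, one_mem_cell hQ⟩
  minimal := by
    rintro K' hK ⟨w, hw⟩ hinv
    have htop := eq_top_of_cellVector_mem hQ _ hinv (hK.1 hw)
      ((cellVector_mem_cellSubspace_iff (hK.1 hw) hK.1).mpr hw)
    refine hK.2 fun x hx => (cellVector_mem_cellSubspace_iff (F := F) hx hK.1).mp ?_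
    rw [htop]
    trivial

end Seminormal

/-! ### Column antisymmetrizers -/

section ColumnAntisymmetrizer

open Tableau

theorem mem_columnStabilizer {lam : YoungDiagram} {n : ℕ} {t : Tableau lam n}
    {π : Equiv.Perm (Fin n)} : π ∈ columnStabilizer t ↔ ∀ i, t.colOf (π i) = t.colOf i := by
  simp [columnStabilizer]

theorem mul_mem_columnStabilizer {lam : YoungDiagram} {n : ℕ} {t : Tableau lam n}
    {π τ : Equiv.Perm (Fin n)} (hπ : π ∈ columnStabilizer t) (hτ : τ ∈ columnStabilizer t) :
    π * τ ∈ columnStabilizer t := by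
  rw [mem_columnStabilizer] at *
  exact fun i => (hπ (τ i)).trans (hτ i)

theorem inv_mem_columnStabilizer {lam : YoungDiagram} {n : ℕ} {t : Tableau lam n}
    {π : Equiv.Perm (Fin n)} (hπ : π ∈ columnStabilizer t) : π⁻¹ ∈ columnStabilizer t := by
  rw [mem_columnStabilizer] at *
  exact fun i => by simpa using (hπ (π⁻¹ i)).symm

variable {F : Type*} [Field F] {lam : YoungDiagram} {n : ℕ} {V V' : Type*} [AddCommGroup V]
  [Module F V] [AddCommGroup V'] [Module F V']

/-- The operator `∑ sgn(π) ρ(π)`, the sum over the column stabilizer of `t`. -/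
noncomputable def columnAntisymmetrizer (ρ : Representation F (Equiv.Perm (Fin n)) V)
    (t : Tableau lam n) : V →ₗ[F] V :=
  ∑ π ∈ columnStabilizer t, (((Equiv.Perm.sign π : ℤˣ) : ℤ) : F) • ρ π

theorem columnAntisymmetrizer_apply (ρ : Representation F (Equiv.Perm (Fin n)) V)
    (t : Tableau lam n) (v : V) : columnAntisymmetrizer ρ t v =
      ∑ π ∈ columnStabilizer t, (((Equiv.Perm.sign π : ℤˣ) : ℤ) : F) • ρ π v := by
  simp [columnAntisymmetrizer]

theorem columnAntisymmetrizer_map {ρ : Representation F (Equiv.Perm (Fin n)) V}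
    {σ : Representation F (Equiv.Perm (Fin n)) V'} (f : V →ₗ[F] V')
    (hf : ∀ g v, f (ρ g v) = σ g (f v)) (t : Tableau lam n) (v : V) :
    f (columnAntisymmetrizer ρ t v) = columnAntisymmetrizer σ t (f v) := by
  simp [columnAntisymmetrizer_apply, hf]

theorem sign_mul_sign_self (π : Equiv.Perm (Fin n)) :
    (((Equiv.Perm.sign π : ℤˣ) : ℤ) : F) * (((Equiv.Perm.sign π : ℤˣ) : ℤ) : F) = 1 := by
  rw [← Int.cast_mul, ← Units.val_mul, Int.units_mul_self, Units.val_one, Int.cast_one]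

theorem columnAntisymmetrizer_apply_of_mem (ρ : Representation F (Equiv.Perm (Fin n)) V)
    {t : Tableau lam n} {τ : Equiv.Perm (Fin n)} (hτ : τ ∈ columnStabilizer t) (v : V) :
    columnAntisymmetrizer ρ t (ρ τ v) =
      (((Equiv.Perm.sign τ : ℤˣ) : ℤ) : F) • columnAntisymmetrizer ρ t v := by
  rw [columnAntisymmetrizer_apply, columnAntisymmetrizer_apply, Finset.smul_sum]
  refine Finset.sum_bij' (fun π _ => π * τ) (fun π _ => π * τ⁻¹)
    (fun π hπ => mul_mem_columnStabilizer hπ hτ)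
    (fun π hπ => mul_mem_columnStabilizer hπ (inv_mem_columnStabilizer hτ))
    (fun π _ => by group) (fun π _ => by group) (fun π _ => ?_)
  rw [map_mul, map_mul, Module.End.mul_apply, smul_smul, Units.val_mul, Int.cast_mul,
    mul_left_comm, sign_mul_sign_self, mul_one]

/-- The transposition lies in the column stabilizer, so the image of a vector fixed by it equals its
own negative. -/
theorem columnAntisymmetrizer_eq_zero [CharZero F]
    (ρ : Representation F (Equiv.Perm (Fin n)) V) {t : Tableau lam n} {a b : Fin n} (hab : a ≠ b)
    (hcol : t.colOf a = t.colOf b) {v : V} (hv : ρ (Equiv.swap a b) v = v) :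
    columnAntisymmetrizer ρ t v = 0 := by
  have hmem : Equiv.swap a b ∈ columnStabilizer t := by
    rw [mem_columnStabilizer]
    intro i
    rw [Equiv.swap_apply_def]
    split_ifs with h1 h2
    · rw [h1, hcol]
    · rw [h2, hcol]
    · rfl
  have h := columnAntisymmetrizer_apply_of_mem ρ hmem v
  rw [hv, Equiv.Perm.sign_swap hab] at h
  simp only [Units.val_neg, Units.val_one, Int.cast_neg, Int.cast_one, neg_one_smul] at h
  have h2 : (2 : F) • columnAntisymmetrizer ρ t v = 0 := by
    rw [two_smul]
    nth_rewrite 1 [h]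
    exact neg_add_cancel _
  exact (smul_eq_zero.mp h2).resolve_left two_ne_zero

/-- On a vector that transforms by the sign, the antisymmetrizer acts by a nonzero scalar. -/
theorem columnAntisymmetrizer_of_sign {ρ : Representation F (Equiv.Perm (Fin n)) V}
    {t : Tableau lam n} {v : V} (hv : ∀ π ∈ columnStabilizer t,
      ρ π v = (((Equiv.Perm.sign π : ℤˣ) : ℤ) : F) • v) :
    columnAntisymmetrizer ρ t v = ((columnStabilizer t).card : F) • v := by
  rw [columnAntisymmetrizer_apply, Finset.sum_congr rfl fun π hπ => by
    rw [hv π hπ, smul_smul, sign_mul_sign_self, one_smul], Finset.sum_const, Nat.cast_smul_eq_nsmul]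

theorem card_columnStabilizer_ne_zero [CharZero F] (t : Tableau lam n) :
    ((columnStabilizer t).card : F) ≠ 0 := by
  rw [Nat.cast_ne_zero]
  exact Finset.card_ne_zero_of_mem (a := 1) (mem_columnStabilizer.mpr fun _ => rfl)

theorem apply_columnAntisymmetrizer_of_mem (ρ : Representation F (Equiv.Perm (Fin n)) V)
    {t : Tableau lam n} {τ : Equiv.Perm (Fin n)} (hτ : τ ∈ columnStabilizer t) (v : V) :
    ρ τ (columnAntisymmetrizer ρ t v) =
      (((Equiv.Perm.sign τ : ℤˣ) : ℤ) : F) • columnAntisymmetrizer ρ t v := by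
  rw [columnAntisymmetrizer_apply, map_sum, Finset.smul_sum]
  refine Finset.sum_bij' (fun π _ => τ * π) (fun π _ => τ⁻¹ * π)
    (fun π hπ => mul_mem_columnStabilizer hτ hπ)
    (fun π hπ => mul_mem_columnStabilizer (inv_mem_columnStabilizer hτ) hπ)
    (fun π _ => by group) (fun π _ => by group) (fun π _ => ?_)
  rw [map_smul, map_mul, map_mul, Module.End.mul_apply, smul_smul, Units.val_mul, Int.cast_mul,
    ← mul_assoc, sign_mul_sign_self, one_mul]

end ColumnAntisymmetrizer

/-! ### Rows of one tableau against columns of another -/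

section RowsAndColumns

open Tableau

/-- A set of `m + 1` naturals has maximum at least `m`; remove it and induct. Equality forces the
maximum to be `m`, hence the set to be the initial segment. -/
theorem Finset.sum_range_card_le (s : Finset ℕ) : ∑ x ∈ Finset.range s.card, x ≤ ∑ x ∈ s, x ∧
    (∑ x ∈ Finset.range s.card, x = ∑ x ∈ s, x → s = Finset.range s.card) := by
  induction hm : s.card generalizing s with
  | zero => simp [Finset.card_eq_zero.mp hm]
  | succ m ih =>
    have hne : s.Nonempty := Finset.card_pos.mp (by omega)
    have hM := s.max'_mem hne
    have hsub : s ⊆ Finset.range (s.max' hne + 1) := fun x hx =>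
      Finset.mem_range.mpr (Nat.lt_succ_of_le (s.le_max' x hx))
    have hle := Finset.card_le_card hsub
    rw [Finset.card_range, hm] at hle
    have h := (ih (s.erase (s.max' hne)) (by rw [Finset.card_erase_of_mem hM, hm]; rfl)).1
    have hs := Finset.add_sum_erase s (fun x => x) hM
    rw [Finset.sum_range_succ]
    refine ⟨by omega, fun he => ?_⟩
    have hMm : s.max' hne = m := by omega
    rw [hMm] at hsub
    exact Finset.eq_of_subset_of_card_le hsub (by simp [hm])

namespace Tableau

variable {lam mu : YoungDiagram} {n : ℕ}

theorem image_rowOf_filter_colOf (t : Tableau lam n) (j : ℕ) :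
    (Finset.univ.filter fun i => t.colOf i = j).image t.rowOf = Finset.range (lam.colLen j) := by
  ext r
  simp only [Finset.mem_image, Finset.mem_filter, Finset.mem_univ, true_and, Finset.mem_range,
    ← YoungDiagram.mem_iff_lt_colLen]
  constructor
  · rintro ⟨i, rfl, rfl⟩
    exact t.mem_shape i
  · intro h
    obtain ⟨i, hr, hc⟩ := t.exists_entry h
    exact ⟨i, hc, hr⟩

theorem card_filter_rowOf (t : Tableau lam n) (r : ℕ) :
    (Finset.univ.filter fun i => t.rowOf i = r).card = lam.rowLen r := by
  rw [← Finset.card_range (lam.rowLen r), ← Finset.card_image_of_injOn (f := t.colOf)]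
  · congr 1
    ext c
    simp only [Finset.mem_image, Finset.mem_filter, Finset.mem_univ, true_and, Finset.mem_range,
      ← YoungDiagram.mem_iff_lt_rowLen]
    constructor
    · rintro ⟨i, rfl, rfl⟩
      exact t.mem_shape i
    · intro h
      obtain ⟨i, hr, hc⟩ := t.exists_entry h
      exact ⟨i, hr, hc⟩
  · intro a ha b hb hab
    simp only [Finset.coe_filter, Finset.mem_univ, true_and, Set.mem_ofPred_eq] at ha hb
    exact t.eq_of_rowOf_of_colOf (ha.trans hb.symm) hab

/-- The shape of a tableau is determined by the rows of its entries. -/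
theorem shape_eq_of_rowOf_eq (t : Tableau lam n) (u : Tableau mu n) (h : t.rowOf = u.rowOf) :
    lam = mu := by
  ext ⟨a, b⟩
  rw [YoungDiagram.mem_cells, YoungDiagram.mem_cells, YoungDiagram.mem_iff_lt_rowLen,
    YoungDiagram.mem_iff_lt_rowLen, ← t.card_filter_rowOf, ← u.card_filter_rowOf, h]

/-- If the entries of each column of `t` have distinct labels `r`, then the sum of the labels is
at least that of the row numbers, and in the case of equality the labels are row numbers of a
tableau with the same columns. -/
theorem sum_rowOf_le (t : Tableau lam n) (r : Fin n → ℕ)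
    (h : ∀ a b, a ≠ b → t.colOf a = t.colOf b → r a ≠ r b) :
    ∑ i, t.rowOf i ≤ ∑ i, r i ∧
      (∑ i, t.rowOf i = ∑ i, r i → ∃ u : Tableau lam n, u.rowOf = r ∧ u.colOf = t.colOf) := by
  let J := Finset.univ.image t.colOf
  let S : ℕ → Finset (Fin n) := fun j => Finset.univ.filter fun i => t.colOf i = j
  have hsum : ∀ f : Fin n → ℕ, ∑ i, f i = ∑ j ∈ J, ∑ i ∈ S j, f i := fun f =>
    (Finset.sum_fiberwise_of_maps_to (fun i hi => Finset.mem_image_of_mem _ hi) f).symm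
  have himage : ∀ f : Fin n → ℕ, (∀ a b, a ≠ b → t.colOf a = t.colOf b → f a ≠ f b) → ∀ j,
      ∑ i ∈ S j, f i = ∑ x ∈ (S j).image f, x ∧ ((S j).image f).card = (S j).card := by
    intro f hf j
    have hinj : Set.InjOn f (S j) := by
      intro a ha b hb hab
      simp only [S, Finset.coe_filter, Finset.mem_univ, true_and, Set.mem_ofPred_eq] at ha hb
      by_contra hne
      exact hf a b hne (ha.trans hb.symm) hab
    exact ⟨(Finset.sum_image (f := fun x => x) hinj).symm, Finset.card_image_of_injOn hinj⟩
  have hrow := himage t.rowOf fun a b hab hc hr => hab (t.eq_of_rowOf_of_colOf hr hc)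
  have hlab := himage r h
  have hS : ∀ j, (S j).image t.rowOf = Finset.range (S j).card := fun j => by
    have h1 := t.image_rowOf_filter_colOf j
    rw [← (hrow j).2]
    simp only [S]
    rw [h1, Finset.card_range]
  have hle : ∀ j ∈ J, ∑ i ∈ S j, t.rowOf i ≤ ∑ i ∈ S j, r i := fun j _ => by
    rw [(hrow j).1, (hlab j).1, hS, ← (hlab j).2]
    exact (Finset.sum_range_card_le _).1
  rw [hsum t.rowOf, hsum r]
  refine ⟨Finset.sum_le_sum hle, fun he => ?_⟩
  -- Equal totals force equality in every column, so the labels of a column of length `m` are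
  -- exactly `0, …, m - 1`.
  rw [Finset.sum_eq_sum_iff_of_le hle] at he
  have hmem : ∀ i, (r i, t.colOf i) ∈ lam := by
    intro i
    have hi := he (t.colOf i) (Finset.mem_image_of_mem _ (Finset.mem_univ i))
    rw [(hrow _).1, (hlab _).1, hS, ← (hlab _).2] at hi
    have h2 := (Finset.sum_range_card_le _).2 hi
    rw [(hlab _).2, ← hS] at h2
    have h3 : r i ∈ (S (t.colOf i)).image r :=
      Finset.mem_image_of_mem _ (by simp [S])
    rw [h2] at h3
    simp only [S] at h3
    rw [t.image_rowOf_filter_colOf, Finset.mem_range] at h3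
    exact YoungDiagram.mem_iff_lt_colLen.mpr h3
  let f : Fin n → {c : ℕ × ℕ // c ∈ lam} := fun i => ⟨(r i, t.colOf i), hmem i⟩
  have hf : Function.Injective f := by
    intro a b hab
    have hab' := Prod.mk.inj (Subtype.mk.inj hab)
    by_contra hne
    exact h a b hne hab'.2 hab'.1
  have hbij : Function.Bijective f := by
    have : Function.Bijective (t ∘ f) := Finite.injective_iff_bijective.mp (t.injective.comp hf)
    exact (Function.Bijective.of_comp_iff' t.bijective f).mp this
  exact ⟨(Equiv.ofBijective f hbij).symm, rfl, rfl⟩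

theorem sum_rowOf_eq (t u : Tableau lam n) : ∑ i, t.rowOf i = ∑ i, u.rowOf i := by
  rw [← Equiv.sum_comp (u.symm.trans t) t.rowOf]
  simp [rowOf]

end Tableau

end RowsAndColumns

/-! ### Specht modules -/

section SpechtModules

open Tableau

variable {F : Type*} [Field F] {lam mu : YoungDiagram} {n : ℕ}

theorem Tabloid.mk_eq_mk {t u : Tableau lam n} : Tabloid.mk t = Tabloid.mk u ↔
    t.rowOf = u.rowOf := by
  rw [funext_iff]
  exact Quotient.eq (r := rowSetoid lam n)

theorem columnAntisymmetrizer_single_mk (t : Tableau lam n) :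
    columnAntisymmetrizer (Representation.ofMulAction F (Equiv.Perm (Fin n)) (Tabloid lam n)) t
      (MonoidAlgebra.single (Tabloid.mk t) 1) = polytabloid F t := by
  simp [columnAntisymmetrizer_apply, polytabloid, Tabloid.smul_mk]

/-- If `a` and `b` shared a column of `t` and a row of `u`, their transposition would fix the
tabloid of `u` and the antisymmetrizer would kill it. -/
theorem rowOf_ne_of_columnAntisymmetrizer_ne_zero [CharZero F] {t : Tableau lam n}
    {u : Tableau mu n} (h : columnAntisymmetrizer
      (Representation.ofMulAction F (Equiv.Perm (Fin n)) (Tabloid mu n)) t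
      (MonoidAlgebra.single (Tabloid.mk u) 1) ≠ 0) (a b : Fin n) (hab : a ≠ b)
    (hcol : t.colOf a = t.colOf b) : u.rowOf a ≠ u.rowOf b := by
  intro hrow
  refine h (columnAntisymmetrizer_eq_zero _ hab hcol ?_)
  rw [Representation.ofMulAction_single, Tabloid.smul_mk]
  congr 1
  rw [Tabloid.mk_eq_mk]
  funext i
  rw [rowOf_permute, Equiv.swap_inv, Equiv.swap_apply_def]
  split_ifs with h1 h2
  · rw [h1, hrow]
  · rw [h2, hrow]
  · rfl

theorem tabloid_span_induction {P : MonoidAlgebra F (Tabloid mu n) → Prop} (zero : P 0)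
    (add : ∀ x y, P x → P y → P (x + y)) (smul : ∀ (c : F) x, P x → P (c • x))
    (single : ∀ u, P (MonoidAlgebra.single (Tabloid.mk u) 1)) (x) : P x := by
  induction x using MonoidAlgebra.induction_linear with
  | zero => exact zero
  | add x y hx hy => exact add x y hx hy
  | single q c =>
    induction q using Quotient.inductionOn with
    | h u =>
      have := smul c _ (single u)
      rwa [MonoidAlgebra.smul_single, smul_eq_mul, mul_one] at this

/-- The antisymmetrizer of `t` maps the permutation module on tabloids to the multiples of the
polytabloid of `t`. -/
theorem columnAntisymmetrizer_mem_span [CharZero F] (t : Tableau lam n)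
    (x : MonoidAlgebra F (Tabloid lam n)) :
    columnAntisymmetrizer (Representation.ofMulAction F (Equiv.Perm (Fin n)) (Tabloid lam n)) t x ∈
      Submodule.span F {polytabloid F t} := by
  induction x using tabloid_span_induction with
  | zero => simp
  | add x y hx hy => rw [map_add]; exact add_mem hx hy
  | smul c x hx => rw [map_smul]; exact Submodule.smul_mem _ c hx
  | single u =>
    by_cases h0 : columnAntisymmetrizer
      (Representation.ofMulAction F (Equiv.Perm (Fin n)) (Tabloid lam n)) t
      (MonoidAlgebra.single (Tabloid.mk u) 1) = 0
    · rw [h0]; exact zero_mem _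
    · obtain ⟨u', hr, hc⟩ := (t.sum_rowOf_le u.rowOf
        (rowOf_ne_of_columnAntisymmetrizer_ne_zero h0)).2 (t.sum_rowOf_eq u)
      let π : Equiv.Perm (Fin n) := t.symm.trans u'
      have hπ : t.permute π = u' := by ext c; simp [π, permute]
      have hmem : π ∈ columnStabilizer t := by
        rw [mem_columnStabilizer]
        intro i
        have h1 : u'.colOf (π i) = t.colOf i := by simp [π, colOf]
        rwa [hc] at h1
      have : Tabloid.mk u = π • Tabloid.mk t := by
        rw [Tabloid.smul_mk, hπ, Tabloid.mk_eq_mk, hr]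
      rw [this, ← Representation.ofMulAction_single, columnAntisymmetrizer_apply_of_mem _ hmem,
        columnAntisymmetrizer_single_mk]
      exact Submodule.smul_mem _ _ (Submodule.mem_span_singleton_self _)

/-- The coefficient at the tabloid of `t` is `1`: a column permutation that also preserves the rows
is trivial. -/
theorem polytabloid_ne_zero (t : Tableau lam n) : polytabloid F t ≠ 0 := by
  classical
  intro h
  have h1 := congrArg (fun x : MonoidAlgebra F (Tabloid lam n) => x.coeff (Tabloid.mk t)) h
  simp only [polytabloid, MonoidAlgebra.coeff_sum, Finsupp.finsetSum_apply,
    MonoidAlgebra.coeff_zero, Finsupp.zero_apply] at h1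
  rw [Finset.sum_eq_single 1] at h1
  · have h2 : t.permute 1 = t := rfl
    simp [h2] at h1
  · intro π hπ hne
    rw [MonoidAlgebra.coeff_single, Finsupp.single_apply, if_neg]
    intro he
    rw [Tabloid.mk_eq_mk] at he
    refine hne (Equiv.ext fun i => t.eq_of_rowOf_of_colOf ?_ (mem_columnStabilizer.mp hπ i))
    have h2 := congrFun he (π i)
    simpa [rowOf_permute] using h2.symm
  · intro h
    exact absurd (mem_columnStabilizer.mpr fun _ => rfl) h

theorem apply_polytabloid_of_mem (t : Tableau lam n) {π : Equiv.Perm (Fin n)}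
    (hπ : π ∈ columnStabilizer t) :
    Representation.ofMulAction F (Equiv.Perm (Fin n)) (Tabloid lam n) π (polytabloid F t) =
      (((Equiv.Perm.sign π : ℤˣ) : ℤ) : F) • polytabloid F t := by
  rw [← columnAntisymmetrizer_single_mk, apply_columnAntisymmetrizer_of_mem _ hπ]

variable (F) in
/-- The polytabloid of `t` as an element of the Specht module. -/
noncomputable def spechtVector (t : Tableau lam n) : (spechtModule F lam n).toSubmodule :=
  ⟨polytabloid F t, Submodule.subset_span ⟨t, rfl⟩⟩

theorem coe_columnAntisymmetrizer_specht (t : Tableau mu n)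
    (x : (spechtModule F lam n).toSubmodule) :
    ((columnAntisymmetrizer (spechtModule F lam n).toRepresentation t x :
      (spechtModule F lam n).toSubmodule) : MonoidAlgebra F (Tabloid lam n)) =
    columnAntisymmetrizer (Representation.ofMulAction F (Equiv.Perm (Fin n)) (Tabloid lam n)) t x :=
  columnAntisymmetrizer_map (Submodule.subtype _) (fun _ _ => rfl) t x

theorem columnAntisymmetrizer_specht_mem_span [CharZero F] (t : Tableau lam n)
    (x : (spechtModule F lam n).toSubmodule) :
    ∃ c : F, columnAntisymmetrizer (spechtModule F lam n).toRepresentation t x =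
      c • spechtVector F t := by
  obtain ⟨c, hc⟩ := Submodule.mem_span_singleton.mp (columnAntisymmetrizer_mem_span t x.1)
  exact ⟨c, Subtype.ext ((coe_columnAntisymmetrizer_specht t x).trans hc.symm)⟩

theorem spechtVector_ne_zero (t : Tableau lam n) : spechtVector F t ≠ 0 := fun h =>
  polytabloid_ne_zero t (congrArg Subtype.val h)

theorem specht_apply_of_mem (t : Tableau lam n) {π : Equiv.Perm (Fin n)}
    (hπ : π ∈ columnStabilizer t) :
    (spechtModule F lam n).toRepresentation π (spechtVector F t) =
      (((Equiv.Perm.sign π : ℤˣ) : ℤ) : F) • spechtVector F t :=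
  Subtype.ext (apply_polytabloid_of_mem t hπ)

theorem specht_eq_top_of_mem (t : Tableau lam n)
    (U : Subrepresentation (spechtModule F lam n).toRepresentation)
    (h : spechtVector F t ∈ U.toSubmodule) : U = ⊤ := by
  apply Subrepresentation.toSubmodule_injective
  change U.toSubmodule = ⊤
  rw [eq_top_iff]
  have hle : (spechtModule F lam n).toSubmodule ≤ U.toSubmodule.map (Submodule.subtype _) := by
    refine Submodule.span_le.mpr ?_
    rintro _ ⟨t', rfl⟩
    refine ⟨_, U.apply_mem_toSubmodule (t.symm.trans t') h, ?_⟩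
    refine (ofMulAction_polytabloid F (t.symm.trans t') t).trans ?_
    congr 1
    ext c
    simp [permute]
  intro x _
  obtain ⟨y, hy, hyx⟩ := hle x.2
  rwa [← Subtype.ext hyx]

-- Split the Specht module as `U ⊕ U'` by Maschke. The antisymmetrizer multiplies the polytabloid of
-- `t` by a nonzero scalar, so it is nonzero on one of its two components. The image there is a
-- nonzero multiple of the polytabloid, which generates everything.
variable (F) in
theorem isIrreducible_specht [CharZero F] (t : Tableau lam n) :
    (spechtModule F lam n).toRepresentation.IsIrreducible := by
  have hnt : Nontrivial (Subrepresentation (spechtModule F lam n).toRepresentation) := by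
    refine ⟨⊥, ⊤, fun h => spechtVector_ne_zero (F := F) t ?_⟩
    have : spechtVector F t ∈ (⊤ : Subrepresentation
      (spechtModule F lam n).toRepresentation).toSubmodule := Submodule.mem_top
    rw [← h] at this
    exact (Submodule.mem_bot F).mp this
  refine ⟨fun U => ?_⟩
  have : NeZero (Nat.card (Equiv.Perm (Fin n)) : F) := ⟨Nat.cast_ne_zero.mpr Nat.card_pos.ne'⟩
  obtain ⟨U', hU⟩ := exists_isCompl U
  have key : ∀ (U : Subrepresentation (spechtModule F lam n).toRepresentation), ∀ x ∈ U.toSubmodule,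
      columnAntisymmetrizer (spechtModule F lam n).toRepresentation t x ≠ 0 → U = ⊤ := by
    intro U x hx hne
    obtain ⟨c, hc⟩ := columnAntisymmetrizer_specht_mem_span t x
    have hmem : columnAntisymmetrizer (spechtModule F lam n).toRepresentation t x ∈
        U.toSubmodule := by
      rw [columnAntisymmetrizer_apply]
      exact Submodule.sum_mem _ fun π _ => U.toSubmodule.smul_mem _ (U.apply_mem_toSubmodule π hx)
    rw [hc] at hmem hne
    exact specht_eq_top_of_mem t U
      ((U.toSubmodule.smul_mem_iff (left_ne_zero_of_smul hne)).mp hmem)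
  have htop : spechtVector F t ∈ U.toSubmodule ⊔ U'.toSubmodule := by
    have h : (U ⊔ U').toSubmodule = ⊤ := congrArg _ hU.sup_eq_top
    rw [Subrepresentation.toSubmodule_sup] at h
    rw [h]
    trivial
  obtain ⟨x, hx, y, hy, hxy⟩ := Submodule.mem_sup.mp htop
  have hsum := columnAntisymmetrizer_of_sign (fun π hπ => specht_apply_of_mem (F := F) t hπ)
  rw [← hxy, map_add, hxy] at hsum
  have hne : columnAntisymmetrizer (spechtModule F lam n).toRepresentation t x +
      columnAntisymmetrizer (spechtModule F lam n).toRepresentation t y ≠ 0 := by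
    rw [hsum]
    exact smul_ne_zero (card_columnStabilizer_ne_zero t) (spechtVector_ne_zero t)
  by_cases h0 : columnAntisymmetrizer (spechtModule F lam n).toRepresentation t x = 0
  · have hU' : U' = ⊤ := key U' y hy (by rwa [h0, zero_add] at hne)
    left
    simpa [hU'] using hU.inf_eq_bot
  · exact Or.inr (key U x hx h0)

/-- Otherwise the antisymmetrizer of `t` kills all tabloids of shape `mu`, hence the Specht module
of `mu`, although it does not kill the polytabloid of `t`. -/
theorem exists_rowOf_ne_of_specht_equiv [CharZero F] (t : Tableau lam n)
    (f : (spechtModule F lam n).toRepresentation.Equiv (spechtModule F mu n).toRepresentation) :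
    ∃ u : Tableau mu n, ∀ a b, a ≠ b → t.colOf a = t.colOf b → u.rowOf a ≠ u.rowOf b := by
  by_contra hcon
  push Not at hcon
  have hzero : ∀ x, columnAntisymmetrizer
      (Representation.ofMulAction F (Equiv.Perm (Fin n)) (Tabloid mu n)) t x = 0 := by
    intro x
    induction x using tabloid_span_induction with
    | zero => simp
    | add x y hx hy => rw [map_add, hx, hy, add_zero]
    | smul c x hx => rw [map_smul, hx, smul_zero]
    | single u =>
      by_contra h0
      obtain ⟨a, b, hab, hc, hr⟩ := hcon u
      exact rowOf_ne_of_columnAntisymmetrizer_ne_zero h0 a b hab hc hr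
  have h1 := columnAntisymmetrizer_map (σ := (spechtModule F mu n).toRepresentation)
    f.toLinearMap (fun g v => f.toIntertwiningMap.isIntertwining _ _ g v) t (spechtVector F t)
  rw [columnAntisymmetrizer_of_sign (fun π hπ => specht_apply_of_mem (F := F) t hπ)] at h1
  have h2 : columnAntisymmetrizer (spechtModule F mu n).toRepresentation t
      (f.toLinearMap (spechtVector F t)) = 0 :=
    Subtype.ext ((coe_columnAntisymmetrizer_specht t _).trans (hzero _))
  rw [h2, map_smul] at h1
  have h3 := (smul_eq_zero.mp h1).resolve_left (card_columnStabilizer_ne_zero t)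
  exact spechtVector_ne_zero (F := F) t (f.toLinearEquiv.map_eq_zero_iff.mp h3)

/-- Specht modules of different shapes are not isomorphic. -/
theorem shape_eq_of_specht_equiv [CharZero F] (t : Tableau lam n) (u : Tableau mu n)
    (f : (spechtModule F lam n).toRepresentation.Equiv (spechtModule F mu n).toRepresentation) :
    lam = mu := by
  obtain ⟨u', hu⟩ := exists_rowOf_ne_of_specht_equiv t f
  obtain ⟨t', ht⟩ := exists_rowOf_ne_of_specht_equiv u f.symm
  obtain ⟨h1, h1'⟩ := t.sum_rowOf_le _ hu
  have h2 := (u.sum_rowOf_le _ ht).1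
  -- The sum of row numbers, which depends only on the shape, replaces the dominance order: the two
  -- inequalities force equality, and then some tableau of shape `lam` has the rows of `u'`.
  obtain ⟨s, hs, -⟩ := h1' (le_antisymm h1 (by
    rw [u'.sum_rowOf_eq u, t.sum_rowOf_eq t']; exact h2))
  exact s.shape_eq_of_rowOf_eq u' hs

end SpechtModules

/-! ### The seminormal representation is the Specht module -/

section SpechtIso

open Tableau

variable {F : Type*} [Field F] {lam : YoungDiagram} {n : ℕ} {V : Type*} [AddCommGroup V]
  [Module F V]

/-- A vector on which the adjacent transpositions preserving a monotone function `f` act by a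
character `χ` transforms by `χ` under all permutations preserving `f`. -/
theorem apply_eq_smul_of_monotone (ρ : Representation F (Equiv.Perm (Fin n)) V)
    (χ : Equiv.Perm (Fin n) →* F) {f : Fin n → ℕ} (hf : Monotone f) {v : V}
    (hv : ∀ i j : Fin n, (i : ℕ) + 1 = j → f i = f j →
      ρ (Equiv.swap i j) v = χ (Equiv.swap i j) • v)
    (π : Equiv.Perm (Fin n)) : (∀ i, f (π i) = f i) → ρ π v = χ π • v := by
  induction π using Equiv.Perm.descent_induction with
  | one => simp
  | step π i j hij hlt ih =>
    intro hπ
    -- A permutation preserving the monotone `f` has descents only inside the blocks where `f` is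
    -- constant.
    have h1 : f j ≤ f i := by rw [← hπ i, ← hπ j]; exact hf hlt.le
    have h2 : f i = f j := le_antisymm (hf (Fin.le_def.mpr (by omega))) h1
    have h3 : ∀ x, f (Equiv.swap i j x) = f x := fun x => by
      rw [Equiv.swap_apply_def]
      split_ifs with hx hx
      · rw [hx, h2]
      · rw [hx, h2]
      · rfl
    have h4 := ih fun x => (hπ _).trans (h3 x)
    have h5 : π = π * Equiv.swap i j * Equiv.swap i j := by
      rw [mul_assoc, Equiv.swap_mul_self, mul_one]
    conv_lhs => rw [h5]
    conv_rhs => rw [h5]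
    rw [map_mul ρ, Module.End.mul_apply, hv i j hij h2, map_smul, h4, smul_smul, map_mul χ (π * _),
      mul_comm]

/-- A vector fixed by the row stabilizer of `t` is the image of the tabloid of `t` under an
equivariant map. -/
theorem exists_tabloid_map (ρ : Representation F (Equiv.Perm (Fin n)) V) (t : Tableau lam n)
    {v : V} (hv : ∀ π : Equiv.Perm (Fin n), (∀ i, t.rowOf (π i) = t.rowOf i) → ρ π v = v) :
    ∃ φ : MonoidAlgebra F (Tabloid lam n) →ₗ[F] V,
      (∀ g x, φ (Representation.ofMulAction F (Equiv.Perm (Fin n)) (Tabloid lam n) g x) =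
        ρ g (φ x)) ∧ φ (MonoidAlgebra.single (Tabloid.mk t) 1) = v := by
  -- The tabloid of `u` goes to the translate of `v` by the permutation taking `t` to `u`; another
  -- representative changes this permutation by an element of the row stabilizer of `t`, which fixes
  -- `v`.
  let f : Tabloid lam n → V := Quotient.lift (fun u : Tableau lam n => ρ (t.symm.trans u) v) (by
    intro u u' h
    have h1 := hv ((t.symm.trans u')⁻¹ * t.symm.trans u) (fun i => by
      have := h (u (t.symm i))
      simp only [rowOf, Equiv.symm_apply_apply] at this
      simp only [rowOf, Equiv.Perm.mul_apply, Equiv.trans_apply, Equiv.Perm.inv_def,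
        Equiv.symm_trans_apply, Equiv.symm_symm, Equiv.symm_apply_apply]
      exact this.symm)
    have h2 := congrArg (ρ (t.symm.trans u')) h1
    rwa [← Module.End.mul_apply, ← map_mul, mul_inv_cancel_left] at h2)
  have hf : ∀ u : Tableau lam n, f (Tabloid.mk u) = ρ (t.symm.trans u) v := fun _ => rfl
  let φ : MonoidAlgebra F (Tabloid lam n) →ₗ[F] V :=
    Finsupp.linearCombination F f ∘ₗ (MonoidAlgebra.coeffLinearEquiv F).toLinearMap
  have hφ : ∀ u : Tableau lam n, φ (MonoidAlgebra.single (Tabloid.mk u) 1) =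
      ρ (t.symm.trans u) v := fun u => by
    simp [φ, hf]
  refine ⟨φ, fun g x => ?_, ?_⟩
  · induction x using tabloid_span_induction with
    | zero => simp
    | add x y hx hy => simp only [map_add, hx, hy]
    | smul c x hx => simp only [map_smul, hx]
    | single u =>
      rw [Representation.ofMulAction_single, Tabloid.smul_mk, hφ, hφ, ← Module.End.mul_apply,
        ← map_mul]
      rfl
  · rw [hφ, Equiv.symm_trans_self]
    exact LinearMap.congr_fun (map_one ρ) v

/-- A representation generated by a vector fixed by the row stabilizer of `t`, and generated by a
nonzero vector that transforms by the sign under the column stabilizer of `t`, is isomorphic to the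
Specht module. -/
theorem nonempty_equiv_specht [CharZero F] {ρ : Representation F (Equiv.Perm (Fin n)) V}
    (t : Tableau lam n) {v u : V}
    (hv : ∀ π : Equiv.Perm (Fin n), (∀ i, t.rowOf (π i) = t.rowOf i) → ρ π v = v)
    (hu : ∀ π ∈ columnStabilizer t, ρ π u = (((Equiv.Perm.sign π : ℤˣ) : ℤ) : F) • u)
    (hu0 : u ≠ 0)
    (hgv : ∀ U : Submodule F V, (∀ g, ∀ x ∈ U, ρ g x ∈ U) → v ∈ U → U = ⊤)
    (hgu : ∀ U : Submodule F V, (∀ g, ∀ x ∈ U, ρ g x ∈ U) → u ∈ U → U = ⊤) :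
    Nonempty (ρ.Equiv (spechtModule F lam n).toRepresentation) := by
  obtain ⟨φ, hφ, hφv⟩ := exists_tabloid_map ρ t hv
  have htop : LinearMap.range φ = ⊤ := by
    refine hgv _ ?_ ⟨_, hφv⟩
    rintro g _ ⟨x, rfl⟩
    exact ⟨_, hφ g x⟩
  obtain ⟨m, hm⟩ : u ∈ LinearMap.range φ := htop ▸ Submodule.mem_top
  obtain ⟨c, hc⟩ := Submodule.mem_span_singleton.mp (columnAntisymmetrizer_mem_span t m)
  -- Antisymmetrizing `φ m = u` shows that a nonzero multiple of `u` is the image of a multiple of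
  -- the polytabloid, so `u` already comes from the Specht module.
  have h1 := columnAntisymmetrizer_map φ hφ t m
  rw [hm, columnAntisymmetrizer_of_sign hu, ← hc, map_smul] at h1
  have hu1 := smul_ne_zero (card_columnStabilizer_ne_zero (F := F) t) hu0
  have hc0 : c ≠ 0 := by
    rintro rfl
    rw [zero_smul] at h1
    exact hu1 h1.symm
  let ψ : (spechtModule F lam n).toRepresentation.IntertwiningMap ρ :=
    LinearMap.intertwiningMap_of_isIntertwiningMap _ _ (φ ∘ₗ Submodule.subtype _)
      fun g x => hφ g x.1
  have hψ : ∀ x, ψ x = φ x.1 := fun _ => rfl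
  have hirr := isIrreducible_specht F t
  have hψu : u ∈ LinearMap.range ψ.toLinearMap := by
    rw [← Submodule.smul_mem_iff _ (card_columnStabilizer_ne_zero (F := F) t), ← h1]
    exact Submodule.smul_mem _ _ ⟨spechtVector F t, rfl⟩
  have hsurj : LinearMap.range ψ.toLinearMap = ⊤ := hgu _ ψ.range.apply_mem_toSubmodule hψu
  have hinj : Function.Injective ψ := by
    refine (Representation.IsIrreducible.injective_or_eq_zero ψ).resolve_right fun h0 => ?_
    obtain ⟨x, hx⟩ := hψu
    rw [h0] at hx
    exact hu0 hx.symm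
  exact ⟨(ψ.ofBijective ⟨hinj, LinearMap.range_eq_top.mp hsurj⟩).symm⟩

variable (F) in
/-- The sign character with values in `F`. -/
def signChar (n : ℕ) : Equiv.Perm (Fin n) →* F :=
  ((Int.castRingHom F : ℤ →* F).comp (Units.coeHom ℤ)).comp Equiv.Perm.sign

namespace Tableau

/-- Exchanging two entries of one row destroys standardness, so the contents differ by `±1`; the
increase along the row fixes the sign. In the seminormal form this gives eigenvalue `1` and no
off-diagonal term. -/
theorem IsStandard.content_of_rowOf_eq {T : Tableau lam n} (h : T.IsStandard) {i j : Fin n}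
    (hij : (i : ℕ) + 1 = j) (hr : T.rowOf i = T.rowOf j) : T.content j - T.content i = 1 := by
  have hne : i ≠ j := fun e => by subst e; omega
  have hlt : i < j := Fin.lt_def.mpr (by omega)
  have hc : T.colOf i < T.colOf j := by
    by_contra hc
    exact hlt.asymm (h.lt hr.ge (by omega) hne.symm)
  have hs : ¬ (T.permute (Equiv.swap i j)).IsStandard := fun hs => by
    refine hlt.asymm (hs.lt (i := j) (j := i) ?_ ?_ hne.symm)
    · simp [rowOf_permute, hr]
    · simp [colOf_permute, hc.le]
  rw [h.permute_swap_iff hij, not_not] at hs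
  unfold content at *
  omega

theorem IsStandard.content_of_colOf_eq {T : Tableau lam n} (h : T.IsStandard) {i j : Fin n}
    (hij : (i : ℕ) + 1 = j) (hc : T.colOf i = T.colOf j) : T.content j - T.content i = -1 := by
  have hne : i ≠ j := fun e => by subst e; omega
  have hlt : i < j := Fin.lt_def.mpr (by omega)
  have hr : T.rowOf i < T.rowOf j := by
    by_contra hr
    exact hlt.asymm (h.lt (by omega) hc.ge hne.symm)
  have hs : ¬ (T.permute (Equiv.swap i j)).IsStandard := fun hs => by
    refine hlt.asymm (hs.lt (i := j) (j := i) ?_ ?_ hne.symm)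
    · simp [rowOf_permute, hr.le]
    · simp [colOf_permute, hc]
  rw [h.permute_swap_iff hij, not_not] at hs
  unfold content at *
  omega

end Tableau

theorem permute_inv_symm_trans (Q T : Tableau lam n) :
    Q.permute (T.symm.trans Q : Equiv.Perm (Fin n))⁻¹ = T := by
  ext c
  simp [permute, Equiv.Perm.inv_def]

theorem seminormalRep_apply_of_rowOf [CharZero F] {Q T : Tableau lam n} (hT : T.IsStandard)
    (hmono : Monotone T.rowOf) (π : Equiv.Perm (Fin n)) (hπ : ∀ i, T.rowOf (π i) = T.rowOf i) :
    seminormalRep F Q π (cellVector F Q.cell (T.symm.trans Q)) =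
      cellVector F Q.cell (T.symm.trans Q) := by
  refine (apply_eq_smul_of_monotone (seminormalRep F Q) 1 hmono (fun i j hij hr => ?_) π hπ).trans
    (one_smul _ _)
  rw [seminormalRep_swap hij, ← content_permute_inv, ← content_permute_inv, permute_inv_symm_trans,
    hT.content_of_rowOf_eq hij hr, seminormalCoeff_eq_zero.mpr (Or.inl rfl)]
  simp

theorem seminormalRep_apply_of_colOf [CharZero F] {Q T : Tableau lam n} (hT : T.IsStandard)
    (hmono : Monotone T.colOf) (π : Equiv.Perm (Fin n)) (hπ : π ∈ columnStabilizer T) :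
    seminormalRep F Q π (cellVector F Q.cell (T.symm.trans Q)) =
      (((Equiv.Perm.sign π : ℤˣ) : ℤ) : F) • cellVector F Q.cell (T.symm.trans Q) := by
  refine apply_eq_smul_of_monotone (seminormalRep F Q) (signChar F n) hmono (fun i j hij hc => ?_) π
    (mem_columnStabilizer.mp hπ)
  have hne : i ≠ j := fun e => by subst e; omega
  rw [seminormalRep_swap hij, ← content_permute_inv, ← content_permute_inv, permute_inv_symm_trans,
    hT.content_of_colOf_eq hij hc, seminormalCoeff_eq_zero.mpr (Or.inr rfl)]
  simp [signChar, Equiv.Perm.sign_swap hne]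

variable (F) in
theorem nonempty_seminormalRep_equiv_specht [CharZero F] {Q : Tableau lam n} (hQ : Q.IsStandard) :
    Nonempty ((seminormalRep F Q).Equiv (spechtModule F lam n).toRepresentation) := by
  obtain ⟨T, hT, hrow⟩ := Q.exists_standard_monotone_rowOf
  obtain ⟨T', hT', hcol⟩ := Q.exists_standard_monotone_colOf
  have hmem : ∀ T : Tableau lam n, T.IsStandard →
      (T.symm.trans Q : Equiv.Perm (Fin n)) ∈ Q.cell := fun T hT => by
    rw [mem_cell_iff, permute_inv_symm_trans]
    exact hT
  -- `g` takes `T'` to `T`, hence conjugates the column stabilizer of `T'` into that of `T`; this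
  -- brings the sign vector to the tableau that carries the row-fixed vector.
  let g : Equiv.Perm (Fin n) := T'.symm.trans T
  let u := cellVector F Q.cell (T'.symm.trans Q)
  have hinv : ∀ x, seminormalRep F Q g⁻¹ (seminormalRep F Q g x) = x := fun x => by
    rw [← Module.End.mul_apply, ← map_mul, inv_mul_cancel, map_one, Module.End.one_apply]
  refine nonempty_equiv_specht T (u := seminormalRep F Q g u)
    (seminormalRep_apply_of_rowOf hT hrow) (fun π hπ => ?_) (fun h0 => ?_)
    (fun U hU hv => eq_top_of_cellVector_mem hQ U hU (hmem T hT) hv) (fun U hU hv => ?_)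
  · have hconj : g⁻¹ * π * g ∈ columnStabilizer T' := by
      rw [mem_columnStabilizer] at hπ ⊢
      intro i
      have h1 : ∀ i, T'.colOf (g⁻¹ i) = T.colOf i := fun i => by
        simp [g, colOf, Equiv.Perm.inv_def]
      have h2 : ∀ i, T.colOf (g i) = T'.colOf i := fun i => by rw [← h1]; simp
      rw [Equiv.Perm.mul_apply, Equiv.Perm.mul_apply, h1, hπ, h2]
    have h := seminormalRep_apply_of_colOf (F := F) (Q := Q) hT' hcol _ hconj
    have hsign : Equiv.Perm.sign (g⁻¹ * π * g) = Equiv.Perm.sign π := by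
      rw [map_mul, map_mul, map_inv, mul_right_comm, inv_mul_cancel, one_mul]
    rw [hsign] at h
    have h' := congrArg (seminormalRep F Q g) h
    rw [map_smul, ← Module.End.mul_apply, ← map_mul, ← mul_assoc, mul_inv_cancel_left, map_mul,
      Module.End.mul_apply] at h'
    exact h'
  · have h1 := hinv u
    rw [h0, map_zero] at h1
    have h2 : u = Finsupp.single ⟨_, hmem T' hT'⟩ 1 := cellVector_of_mem F (hmem T' hT')
    exact Finsupp.single_ne_zero.mpr one_ne_zero (h2.symm.trans h1.symm)
  · refine eq_top_of_cellVector_mem hQ U hU (hmem T' hT') ?_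
    have := hU g⁻¹ _ hv
    rwa [hinv] at this

end SpechtIso

/-! ### Completeness of the Specht modules -/

section Completeness

/-- A family of class functions that is orthogonal with nonzero norms has at most as many members
as there are conjugacy classes. -/
theorem card_le_card_conjClasses {F G ι : Type*} [Field F] [Group G] [Fintype G] [Fintype ι]
    (f : ι → G → F) (hconj : ∀ i g h, f i (h * g * h⁻¹) = f i g)
    (horth : ∀ i j, i ≠ j → ∑ g, f i g * f j g⁻¹ = 0) (hne : ∀ i, ∑ g, f i g * f i g⁻¹ ≠ 0) :
    Fintype.card ι ≤ Nat.card (ConjClasses G) := by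
  classical
  have := Fintype.ofFinite (ConjClasses G)
  let v : ι → ConjClasses G → F := fun i => Quotient.lift (f i) (by
    intro a b hab
    obtain ⟨c, rfl⟩ := isConj_iff.mp hab
    exact (hconj i a c).symm)
  have hv : ∀ i g, v i (ConjClasses.mk g) = f i g := fun _ _ => rfl
  -- The pairing uses `g⁻¹` in place of complex conjugation, so it is bilinear over any field.
  let B : (ConjClasses G → F) →ₗ[F] (ConjClasses G → F) →ₗ[F] F :=
    LinearMap.mk₂ F (fun a b => ∑ g, a (ConjClasses.mk g) * b (ConjClasses.mk g⁻¹))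
      (fun a b c => by simp only [Pi.add_apply, add_mul, Finset.sum_add_distrib])
      (fun r a b => by simp only [Pi.smul_apply, smul_eq_mul, Finset.mul_sum, mul_assoc])
      (fun a b c => by simp only [Pi.add_apply, mul_add, Finset.sum_add_distrib])
      (fun r a b => by simp only [Pi.smul_apply, smul_eq_mul, Finset.mul_sum, mul_left_comm])
  have hB : ∀ i j, B (v i) (v j) = ∑ g, f i g * f j g⁻¹ := fun _ _ => rfl
  have hli : LinearIndependent F v := by
    refine LinearMap.linearIndependent_of_isOrthoᵢ (B := B) ?_ fun i => by rw [hB]; exact hne i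
    rw [LinearMap.isOrthoᵢ_def]
    exact fun i j hij => by rw [hB]; exact horth i j hij
  have := hli.fintype_card_le_finrank
  rwa [Module.finrank_fintype_fun_eq_card, ← Nat.card_eq_fintype_card (α := ConjClasses G)] at this

theorem YoungDiagram.card_ofRowLens (w : List ℕ) (hw : w.SortedGE) :
    (YoungDiagram.ofRowLens w hw).card = w.sum := by
  change (YoungDiagram.cellsOfRowLens w).card = w.sum
  clear hw
  induction w with
  | nil => rfl
  | cons a w ih =>
    rw [YoungDiagram.cellsOfRowLens, Finset.card_union_of_disjoint, Finset.card_map, ih]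
    · simp
    · rw [Finset.disjoint_left]
      rintro ⟨x, y⟩ h1 h2
      simp only [Finset.mem_product, Finset.mem_singleton] at h1
      simp only [Finset.mem_map] at h2
      obtain ⟨c, -, hc⟩ := h2
      have := congrArg Prod.fst hc
      simp [h1.1] at this

/-- The cycle type, as a Young diagram. -/
noncomputable def cycleShape {n : ℕ} (g : Equiv.Perm (Fin n)) : YoungDiagram :=
  YoungDiagram.ofRowLens (g.partition.parts.sort (· ≥ ·))
    (Multiset.pairwise_sort _ _).sortedGE

theorem card_cycleShape {n : ℕ} (g : Equiv.Perm (Fin n)) : (cycleShape g).card = n := by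
  rw [cycleShape, YoungDiagram.card_ofRowLens, ← Multiset.sum_coe, Multiset.sort_eq,
    g.partition.parts_sum, Fintype.card_fin]

/-- The row lengths recover the cycle type, fixed points included, and this determines the conjugacy
class. -/
theorem isConj_of_cycleShape_eq {n : ℕ} {g h : Equiv.Perm (Fin n)}
    (e : cycleShape g = cycleShape h) : IsConj g h := by
  have key : ∀ g : Equiv.Perm (Fin n), ((cycleShape g).rowLens : Multiset ℕ) =
      g.partition.parts := fun g => by
    rw [cycleShape, YoungDiagram.rowLens_ofRowLens_eq_self, Multiset.sort_eq]
    exact fun x hx => g.partition.parts_pos (by simpa using hx)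
  rw [Equiv.Perm.partition_eq_of_isConj, Nat.Partition.ext_iff, ← key, ← key, e]

theorem nonempty_tableau {lam : YoungDiagram} {n : ℕ} (h : lam.card = n) :
    Nonempty (Tableau lam n) :=
  ⟨(Finset.equivFinOfCardEq h : lam.cells ≃ Fin n)⟩

/-- The finite orbit of any nonzero vector spans. This gives the arbitrary irreducible a character.
-/
theorem Representation.IsIrreducible.finiteDimensional {F G V : Type*} [Field F] [Group G]
    [Finite G] [AddCommGroup V] [Module F V] {σ : Representation F G V} (h : σ.IsIrreducible) :
    FiniteDimensional F V := by
  by_cases hV : ∀ v : V, v = 0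
  · have : Subsingleton V := ⟨fun a b => (hV a).trans (hV b).symm⟩
    infer_instance
  push Not at hV
  obtain ⟨v, hv⟩ := hV
  let U : Subrepresentation σ :=
    { toSubmodule := Submodule.span F (Set.range fun g => σ g v)
      apply_mem_toSubmodule := fun g x hx => by
        induction hx using Submodule.span_induction with
        | mem x hx =>
          obtain ⟨k, rfl⟩ := hx
          exact Submodule.subset_span ⟨g * k, by simp⟩
        | zero => simp
        | add x y _ _ hx hy => rw [map_add]; exact add_mem hx hy
        | smul c x _ hx => rw [map_smul]; exact Submodule.smul_mem _ c hx }
  have hvU : v ∈ U.toSubmodule := Submodule.subset_span ⟨1, by simp⟩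
  have hU : U = ⊤ := (IsSimpleOrder.eq_bot_or_eq_top U).resolve_left fun h0 => by
    rw [h0] at hvU
    exact hv ((Submodule.mem_bot F).mp hvU)
  have hspan : Submodule.span F (Set.range fun g => σ g v) = ⊤ :=
    congrArg Subrepresentation.toSubmodule hU
  exact Module.finite_def.mpr (hspan ▸ Submodule.fg_span (Set.finite_range _))

/-- Characters of non-isomorphic irreducible representations are orthogonal, over any field of
characteristic zero. -/
theorem sum_char_mul_char_eq_zero {F G V W : Type*} [Field F] [CharZero F] [Group G] [Fintype G]
    [AddCommGroup V] [Module F V] [FiniteDimensional F V] [AddCommGroup W] [Module F W]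
    [FiniteDimensional F W] {ρ : Representation F G V} {σ : Representation F G W}
    (hρ : ρ.IsIrreducible) (hσ : σ.IsIrreducible) (h : IsEmpty (ρ.Equiv σ)) :
    ∑ g, σ.character g * ρ.character g⁻¹ = 0 := by
  have hc : (Nat.card G : F) ≠ 0 := Nat.cast_ne_zero.mpr Nat.card_pos.ne'
  have := invertibleOfNonzero hc
  have h1 := Representation.card_inv_mul_sum_char_mul_char_eq_finrank ρ σ
  rw [Module.finrank_zero_of_subsingleton, Nat.cast_zero] at h1
  exact (mul_eq_zero.mp h1).resolve_left (inv_ne_zero hc)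

/-- The sum is the group order times the dimension of the endomorphism algebra, which contains the
identity. This dimension may exceed `1` over a field that is not algebraically closed; only its
being nonzero matters. -/
theorem sum_char_mul_char_self_ne_zero {F G V : Type*} [Field F] [CharZero F] [Group G] [Fintype G]
    [AddCommGroup V] [Module F V] [FiniteDimensional F V] {ρ : Representation F G V}
    (hρ : ρ.IsIrreducible) : ∑ g, ρ.character g * ρ.character g⁻¹ ≠ 0 := by
  have hc : (Nat.card G : F) ≠ 0 := Nat.cast_ne_zero.mpr Nat.card_pos.ne'
  have := invertibleOfNonzero hc
  have h1 := Representation.card_inv_mul_sum_char_mul_char_eq_finrank ρ ρ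
  intro h0
  rw [h0, mul_zero, eq_comm, Nat.cast_eq_zero, Module.finrank_zero_iff] at h1
  have hV : ∀ v : V, v = 0 := fun v => by
    have := congrArg (fun f : ρ.IntertwiningMap ρ => f v)
      (h1.elim (Representation.IntertwiningMap.id ρ) 0)
    exact this
  have hsub : ∀ U : Subrepresentation ρ, U = ⊥ := fun U => by
    apply Subrepresentation.toSubmodule_injective
    change U.toSubmodule = ⊥
    exact (Submodule.eq_bot_iff _).mpr fun v _ => hV v
  exact bot_ne_top (hsub ⊤).symm

/-- Every irreducible representation of the symmetric group in characteristic zero is a Specht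
module. -/
theorem exists_specht_equiv {F V : Type*} [Field F] [CharZero F] [AddCommGroup V] [Module F V]
    {n : ℕ} {σ : Representation F (Equiv.Perm (Fin n)) V} (hσ : σ.IsIrreducible) :
    ∃ lam : YoungDiagram, Nonempty (Tableau lam n) ∧
      Nonempty ((spechtModule F lam n).toRepresentation.Equiv σ) := by
  by_contra! hcon
  have hfin := hσ.finiteDimensional
  let shape : ConjClasses (Equiv.Perm (Fin n)) → YoungDiagram := fun c => cycleShape c.out
  have htab : ∀ c, Nonempty (Tableau (shape c) n) := fun c =>
    nonempty_tableau (card_cycleShape c.out)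
  have hirr : ∀ c, (spechtModule F (shape c) n).toRepresentation.IsIrreducible := fun c =>
    isIrreducible_specht F (htab c).some
  have hfd : ∀ c, FiniteDimensional F (spechtModule F (shape c) n).toSubmodule := fun c =>
    (hirr c).finiteDimensional
  have hshape : Function.Injective shape := fun c d h => by
    rw [← Quotient.out_eq c, ← Quotient.out_eq d]
    exact Quotient.sound (isConj_of_cycleShape_eq h)
  have := Fintype.ofFinite (ConjClasses (Equiv.Perm (Fin n)))
  -- The characters of one Specht module per conjugacy class, together with that of `σ` at `none`:
  -- one member too many.
  let f : Option (ConjClasses (Equiv.Perm (Fin n))) → Equiv.Perm (Fin n) → F := fun o =>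
    o.elim σ.character fun c => (spechtModule F (shape c) n).toRepresentation.character
  have hempty : ∀ c, IsEmpty ((spechtModule F (shape c) n).toRepresentation.Equiv σ) := fun c =>
    hcon _ (htab c)
  have hcard := card_le_card_conjClasses f
    (by
      rintro (_ | c) g h
      · exact Representation.char_conj _ _ _
      · exact Representation.char_conj _ _ _)
    (by
      rintro (_ | c) (_ | d) hne
      · exact absurd rfl hne
      · exact sum_char_mul_char_eq_zero (hirr d) hσ (hempty d)
      · exact sum_char_mul_char_eq_zero hσ (hirr c)
          ⟨fun e => (hempty c).elim e.symm⟩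
      · refine sum_char_mul_char_eq_zero (hirr d) (hirr c) ⟨fun e => hne ?_⟩
        rw [hshape (shape_eq_of_specht_equiv (htab d).some (htab c).some e)])
    (by
      rintro (_ | c)
      · exact sum_char_mul_char_self_ne_zero hσ
      · exact sum_char_mul_char_self_ne_zero (hirr c))
  rw [Fintype.card_option, Nat.card_eq_fintype_card] at hcard
  omega

end Completeness

theorem mainTheorem11 (F : Type*) [Field F] [CharZero F] (n : ℕ) :
    (∀ (lam : YoungDiagram) (Q : Tableau lam n), Q.IsStandard →
      IsMinimalAYCell F (adjacentTranspositions n) Q.cell ∧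
      (spechtModule F lam n).toRepresentation.IsIrreducible ∧
      ∃ ρ : Representation F (Equiv.Perm (Fin n)) (Q.cell →₀ F),
        IsMinimalAYPair (adjacentTranspositions n) Q.cell ρ ∧
        Nonempty (ρ.Equiv (spechtModule F lam n).toRepresentation)) ∧
    (∀ (V : Type*) [AddCommGroup V] [Module F V]
      (σ : Representation F (Equiv.Perm (Fin n)) V), σ.IsIrreducible →
      ∃ (K : Set (Equiv.Perm (Fin n))) (ρ : Representation F (Equiv.Perm (Fin n)) (K →₀ F)),
        IsMinimalAYPair (adjacentTranspositions n) K ρ ∧ Nonempty (ρ.Equiv σ)) := by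
  refine ⟨fun lam Q hQ => ⟨⟨_, isMinimalAYPair_seminormalRep hQ⟩, isIrreducible_specht F Q, _,
    isMinimalAYPair_seminormalRep hQ, nonempty_seminormalRep_equiv_specht F hQ⟩, ?_⟩
  intro V _ _ σ hσ
  obtain ⟨lam, ⟨t⟩, ⟨e⟩⟩ := exists_specht_equiv hσ
  -- Any standard tableau of the shape serves; the row by row filling is one.
  obtain ⟨Q, hQ, -⟩ := t.exists_standard_monotone_rowOf
  obtain ⟨e'⟩ := nonempty_seminormalRep_equiv_specht F hQ
  exact ⟨Q.cell, seminormalRep F Q, isMinimalAYPair_seminormalRep hQ, ⟨e'.trans e⟩⟩
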